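/- **Setting.** Let $d\ge 1$ and let $\Gamma$ be the set of locally finite subsets of $\mathbb R^d$, with the $\sigma$-algebra generated by the counts $\eta\mapsto\#(\eta\cap\Delta)$, $\Delta$ bounded Borel; let $\Gamma_0\subset\Gamma$ be the finite configurations. Let $H:\Gamma_0\to\mathbb R\cup\{\infty\}$ be a measurable, translation-invariant, stable Hamiltonian ($H(\eta)\ge -B\,\#\eta$ for some $B>0$) with $H(\emptyset)=0$, $H(\{x\})=0$, and $H(\eta)=\infty$ whenever $H(\gamma)=\infty$ for some $\gamma\subset\eta$. The interaction energy of finite configurations is given by $H(\gamma\cup\eta)=H(\gamma)+W(\gamma\mid\eta)+H(\eta)$ (with $W=\infty$ if $H(\gamma)=\infty$ or $H(\eta)=\infty$), and for infinite $\eta$ it is the limit of $W(\gamma\mid\eta\cap B)$ along growing balls $B$. A probability measure $\mathsf P$ on $\Gamma$ is a $(\mu,H)$-Gibbs measure, $\mu\in\mathbb R$, if it is supported on configurations all of whose finite parts have finite energy and on a set of tempered configurations (a set closed under adding finitely many points, on which, for every finite $\gamma$ disjoint from $\eta$, the above limit exists in $\mathbb R\cup\{\infty\}$ and does not depend on the centre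 of the balls), and if for all measurable $G\ge 0$ $$\int_\Gamma\sum_{x\in\eta}G(x,\eta)\,d\mathsf P(\eta)=\int_{\mathbb R^d}\int_\Gamma G(x,\{x\}\cup\eta)\,e^{\mu-W(\{x\}\mid\eta)}\,d\mathsf P(\eta)\,dx .$$ For a set $\boldsymbol x_n=\{x_1,\dots,x_n\}$ of $n$ points, its correlation functions and Janossy densities ($\Lambda$ bounded Borel) are $$\rho^{(n)}(\boldsymbol x_n)=\int_\Gamma e^{n\mu-H(\boldsymbol x_n)-W(\boldsymbol x_n\mid\eta)}\,d\mathsf P(\eta),\qquad j^{(n)}_\Lambda(\boldsymbol x_n)=\int_{\{\eta\cap\Lambda=\emptyset\}} e^{n\mu-H(\boldsymbol x_n)-W(\boldsymbol x_n\mid\eta)}\,d\mathsf P(\eta).$$ For functions $\Psi,\Phi$ on $\Gamma_0$ write $\Psi^{(k)}(y_1,\dots,y_k)=\Psi(\{y_1,\dots,y_k\})$, $(\Psi*\Phi)(\eta)=\sum_{\gamma\subset\eta}\Psi(\gamma)\Phi(\eta\setminus\gamma)$, $\mathbb 1(\eta)=1$ if $\eta=\emptyset$ and $0$ otherwise, $\exp^*\Psi=\mathbb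 1+\sum_{n\ge1}\frac1{n!}\Psi^{*n}$, and $(D_\gamma\Psi)(\eta)=\Psi(\eta\cup\gamma)$ if $\eta\cap\gamma=\emptyset$, $0$ otherwise. The truncated correlation functions $\rho_T$ are given recursively by $\rho=\exp^*\rho_T$, $\rho_T(\emptyset)=0$. **Theorem.** Let $M,A,r>0$ and $d(r)\in\mathbb R$. There is $D_0>0$ such that the following holds for every $\mu\in\mathbb R$, every $H$ as above and every translation-invariant $(\mu,H)$-Gibbs measure $\mathsf P$ which satisfies a Ruelle bound ($\rho^{(n)}\le\xi^n$ for all $n\ge1$, for some $\xi>0$) and, for some $0<D_\rho\le D_0$, the assumptions * (A) for $n=1,2$ and every bounded $\Delta\subset\mathbb R^d$, $\displaystyle\lim_{\Lambda\nearrow\mathbb R^d}\ \sup_{\boldsymbol x_n\subset\Delta}\Big|\frac{j^{(n)}_\Lambda(\boldsymbol x_n)}{j^{(0)}_\Lambda}-e^{n\mu-H(\boldsymbol x_n)}\Big|=0$ (it suffices that $\Lambda$ runs through some increasing sequence of bounded Borel sets with union $\mathbb R^d$); * (B) for $m=1,2$, all $k\ge1$, all Borel $\Lambda\subset\mathbb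 R^d$ and all sets $\boldsymbol x_m$ of $m$ points, $\displaystyle\int_{\Lambda^k}|\rho_T^{(m+k)}(\boldsymbol x_m,\boldsymbol y_k)|\,d\boldsymbol y_k\le (m+k-1)!\,M A^m D_\rho^k\prod_{i=1}^m\rho^{(1)}(x_i)$; * (C) $\rho^{(1)}>0$, and $\rho^{(1)}(x_1)\rho^{(1)}(x_2)\le d(r)\,\rho^{(2)}(x_1,x_2)$ whenever $|x_1-x_2|\ge r$. The density $\rho^{(1)}\equiv\rho$ is constant; there are families $\omega_x$, $x\in\mathbb R^d$, and $\omega_{x_1,x_2}$, $|x_1-x_2|\ge r$, of functions on $\Gamma_0$ that vanish at $\emptyset$ and are recursively defined such that $$\frac{D_{\{x\}}\rho_T}{\rho^{(1)}(x)}=\exp^*\omega_x,\qquad \frac{D_{\{x_1,x_2\}}\rho_T}{\rho^{(2)}(x_1,x_2)}=\Big(\exp^*\omega_{x_1,x_2}-\frac{\rho^{(1)}(x_1)\rho^{(1)}(x_2)}{\rho^{(2)}(x_1,x_2)}\mathbb 1\Big)*\frac{D_{\{x_1\}}\rho_T}{\rho^{(1)}(x_1)}*\frac{D_{\{x_2\}}\rho_T}{\rho^{(1)}(x_2)};$$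 and, with all integrals and series absolutely convergent, $$\mu=\log\rho+\sum_{k=1}^\infty\frac{(-1)^k}{k!}\int_{(\mathbb R^d)^k}\omega^{(k)}_0(\boldsymbol y_k)\,d\boldsymbol y_k ,$$ and, for all $x_1,x_2$ with $|x_1-x_2|\ge r$, $$H(\{x_1,x_2\})=-\log\Big(\frac{\rho^{(2)}(x_1,x_2)}{\rho^2}\Big)-\sum_{k=1}^\infty\frac{(-1)^k}{k!}\int_{(\mathbb R^d)^k}\omega^{(k)}_{x_1,x_2}(\boldsymbol y_k)\,d\boldsymbol y_k .$$ -/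

import Mathlib

open MeasureTheory Filter Topology
open scoped ENNReal Classical

noncomputable section

namespace InverseGibbs

/-- The space `ℝ^d` with its Euclidean norm. -/
abbrev Space (d : ℕ) : Type := EuclideanSpace ℝ (Fin d)

/-! ### Configurations and point processes -/

/-- The set `Γ` of locally finite configurations in `ℝ^d`. -/
def Configuration (d : ℕ) : Type :=
  {η : Set (Space d) // ∀ Δ : Set (Space d), Bornology.IsBounded Δ → (η ∩ Δ).Finite}

/-- The σ-algebra on `Γ` generated by the events `{N(· ∩ Δ) = m}`, `Δ` bounded Borel. -/
instance Configuration.instMeasurableSpace (d : ℕ) : MeasurableSpace (Configuration d) :=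
  MeasurableSpace.generateFrom
    {S | ∃ (Δ : Set (Space d)) (m : ℕ), Bornology.IsBounded Δ ∧ MeasurableSet Δ ∧
      S = {η : Configuration d | (η.1 ∩ Δ).ncard = m}}

/-- A finite set of points, seen as a configuration. -/
def Configuration.ofFinset {d : ℕ} (x : Finset (Space d)) : Configuration d :=
  ⟨(x : Set (Space d)), fun _ _ => x.finite_toSet.inter_of_left _⟩

/-- The configuration `η ∪ x` for a finite set of points `x`. -/
def Configuration.addPoints {d : ℕ} (η : Configuration d) (x : Finset (Space d)) :
    Configuration d :=
  ⟨η.1 ∪ (x : Set (Space d)), fun Δ hΔ => by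
    rw [Set.union_inter_distrib_right]
    exact (η.2 Δ hΔ).union (x.finite_toSet.inter_of_left _)⟩

/-- The translated configuration `η + a`. -/
def Configuration.translate {d : ℕ} (a : Space d) (η : Configuration d) : Configuration d :=
  ⟨(fun y => y + a) '' η.1, fun Δ hΔ => by
    have hb : Bornology.IsBounded ((fun y => y + -a) '' Δ) := by
      obtain ⟨C, hC⟩ := isBounded_iff_forall_norm_le.1 hΔ
      refine isBounded_iff_forall_norm_le.2 ⟨C + ‖-a‖, ?_⟩
      rintro _ ⟨y, hy, rfl⟩
      exact (norm_add_le _ _).trans (add_le_add (hC y hy) le_rfl)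
    refine ((η.2 _ hb).image (fun y => y + a)).subset ?_
    rintro _ ⟨⟨y, hy, rfl⟩, hyΔ⟩
    exact ⟨y, ⟨hy, ⟨y + a, hyΔ, by simp⟩⟩, rfl⟩⟩

/-- The finitely many points of `η` in the closed ball with centre `a` and radius `R`. -/
def Configuration.inBall {d : ℕ} (η : Configuration d) (a : Space d) (R : ℝ) :
    Finset (Space d) :=
  (η.2 (Metric.closedBall a R) Metric.isBounded_closedBall).toFinset

/-- A point process is translation invariant if its law is invariant under all translations. -/
def TranslationInvariant {d : ℕ} (P : Measure (Configuration d)) : Prop :=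
  ∀ (a : Space d) (S : Set (Configuration d)), MeasurableSet S →
    P (Configuration.translate a ⁻¹' S) = P S

/-! ### Hamiltonians, interaction energy and Gibbs measures -/

/-- A translation-invariant stable Hamiltonian `H : Γ₀ → ℝ ∪ {∞}`; the value `-∞` of `EReal` is
excluded by stability. The energy of the empty configuration is zero, and so is the energy of a
single point (the one-body part of the energy is carried by the chemical potential).
`hereditary` expresses that `H(η' ∪ η) = H(η') + W(η' ∣ η) + H(η)` with `W > -∞`. -/
structure IsHamiltonian {d : ℕ} (H : Finset (Space d) → EReal) : Prop where
  /-- `H` is measurable for the trace on `Γ₀` of the σ-algebra of `Γ`. -/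
  measurable : Measurable[MeasurableSpace.comap Configuration.ofFinset inferInstance] H
  empty : H ∅ = 0
  singleton : ∀ x : Space d, H {x} = 0
  hereditary : ∀ x y : Finset (Space d), x ⊆ y → H x = ⊤ → H y = ⊤
  translate : ∀ (a : Space d) (x : Finset (Space d)), H (x.image fun y => y + a) = H x
  stable : ∃ B : ℝ, 0 < B ∧ ∀ x : Finset (Space d), ((-(B * x.card) : ℝ) : EReal) ≤ H x

/-- The interaction energy `W(x ∣ η)` of finite configurations, i.e. the solution of
`H(x ∪ η) = H(x) + W(x ∣ η) + H(η)`, where `W = ∞` if `H(x) = ∞` or `H(η) = ∞`. -/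
def finiteInteraction {d : ℕ} (H : Finset (Space d) → EReal) (x η : Finset (Space d)) : EReal :=
  if H x = ⊤ ∨ H η = ⊤ then ⊤ else H (x ∪ η) - H x - H η

/-- The interaction energy `W(x ∣ η)` of a finite and a possibly infinite configuration, the limit
of `W(x ∣ η ∩ B_n)` along the growing balls `B_n` (written as a lower limit to be total; on the
tempered configurations in `IsGibbs` it is a limit). -/
def interaction {d : ℕ} (H : Finset (Space d) → EReal) (x : Finset (Space d))
    (η : Configuration d) : EReal :=
  liminf (fun n : ℕ => finiteInteraction H x (η.inBall 0 n)) atTop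

/-- A set `T` of tempered configurations for `H`: it is stable under adding finitely many points,
and for `η ∈ T` the interaction energy of any finite set of further points with `η` is well defined
in `ℝ ∪ {∞}`, as the limit along growing balls, whatever their centre. -/
structure IsTemperedSet {d : ℕ} (H : Finset (Space d) → EReal) (T : Set (Configuration d)) :
    Prop where
  addPoints : ∀ η ∈ T, ∀ x : Finset (Space d), η.addPoints x ∈ T
  limit : ∀ η ∈ T, ∀ x : Finset (Space d), Disjoint (x : Set (Space d)) η.1 →
    ∃ w : EReal, w ≠ ⊥ ∧ ∀ a : Space d,
      Tendsto (fun n : ℕ => finiteInteraction H x (η.inBall a n)) atTop (𝓝 w)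

/-- `P` is a `(μ, H)`-Gibbs measure: it is supported on tempered configurations of locally finite
energy and it satisfies the GNZ equation. -/
structure IsGibbs {d : ℕ} (μ : ℝ) (H : Finset (Space d) → EReal)
    (P : Measure (Configuration d)) : Prop where
  tempered : ∃ T : Set (Configuration d), IsTemperedSet H T ∧ ∀ᵐ η ∂P, η ∈ T
  finite_energy : ∀ᵐ η ∂P, ∀ n : ℕ, H (η.inBall 0 n) ≠ ⊤
  gnz : ∀ G : Space d → Configuration d → ℝ≥0∞, Measurable (Function.uncurry G) →
    ∫⁻ η, ∑' x : η.1, G x η ∂P =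
      ∫⁻ x : Space d, ∫⁻ η, G x (η.addPoints {x}) *
        EReal.exp ((μ : EReal) - interaction H {x} η) ∂P

/-! ### Correlation functions and Janossy densities -/

/-- `exp(n μ - H(x) - W(x ∣ η))` for a set `x` of `n` points. -/
def boltzmann {d : ℕ} (μ : ℝ) (H : Finset (Space d) → EReal) (x : Finset (Space d))
    (η : Configuration d) : ℝ≥0∞ :=
  EReal.exp (((x.card * μ : ℝ) : EReal) - H x - interaction H x η)

/-- The correlation functions `ρ^(n)(x₁, …, xₙ)` of a Gibbs measure, with values in `[0, ∞]`. -/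
def correlation {d : ℕ} (μ : ℝ) (H : Finset (Space d) → EReal) (P : Measure (Configuration d))
    (x : Finset (Space d)) : ℝ≥0∞ :=
  ∫⁻ η, boltzmann μ H x η ∂P

/-- The correlation functions as a real function on finite configurations. -/
def rho {d : ℕ} (μ : ℝ) (H : Finset (Space d) → EReal) (P : Measure (Configuration d))
    (x : Finset (Space d)) : ℝ :=
  (correlation μ H P x).toReal

/-- The Ruelle bound `ρ^(n) ≤ ξ^n`. -/
def RuelleBound {d : ℕ} (μ : ℝ) (H : Finset (Space d) → EReal) (P : Measure (Configuration d)) :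
    Prop :=
  ∃ ξ : ℝ, 0 < ξ ∧ ∀ x : Finset (Space d), x.Nonempty →
    correlation μ H P x ≤ ENNReal.ofReal (ξ ^ x.card)

/-- The Janossy densities `j_Λ^(n)(x₁, …, xₙ)` of a Gibbs measure:
the integral of `exp(n μ - H(x) - W(x ∣ η))` over the `η` without points in `Λ`. -/
def janossy {d : ℕ} (μ : ℝ) (H : Finset (Space d) → EReal) (P : Measure (Configuration d))
    (Λ : Set (Space d)) (x : Finset (Space d)) : ℝ :=
  (∫⁻ η in {η : Configuration d | η.1 ∩ Λ = ∅}, boltzmann μ H x η ∂P).toReal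

/-! ### Ruelle calculus for functions on finite configurations -/

/-- The value `F^(k)(y₁, …, y_k) = F({y₁, …, y_k})`. -/
def atPoints {d : ℕ} (F : Finset (Space d) → ℝ) {k : ℕ} (y : Fin k → Space d) : ℝ :=
  F (Finset.univ.image y)

/-- The product `(Ψ ∗ Φ)(η) = ∑_{γ ⊆ η} Ψ(γ) Φ(η \ γ)`. -/
def starMul {d : ℕ} (Ψ Φ : Finset (Space d) → ℝ) (η : Finset (Space d)) : ℝ :=
  ∑ γ ∈ η.powerset, Ψ γ * Φ (η \ γ)

/-- The unit of the product `∗`. -/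
def starOne {d : ℕ} (η : Finset (Space d)) : ℝ := if η = ∅ then 1 else 0

/-- The powers for the product `∗`. -/
def starPow {d : ℕ} (Ψ : Finset (Space d) → ℝ) : ℕ → Finset (Space d) → ℝ
  | 0 => starOne
  | n + 1 => starMul Ψ (starPow Ψ n)

/-- The star-exponential `exp^∗ Ψ = ∑ₙ Ψ^{∗n} / n!`. -/
def starExp {d : ℕ} (Ψ : Finset (Space d) → ℝ) (η : Finset (Space d)) : ℝ :=
  ∑' n : ℕ, ((n.factorial : ℝ))⁻¹ * starPow Ψ n η

/-- The operator `D_γ`. -/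
def dOp {d : ℕ} (γ : Finset (Space d)) (Ψ : Finset (Space d) → ℝ) (η : Finset (Space d)) : ℝ :=
  if Disjoint η γ then Ψ (η ∪ γ) else 0

/-- The solution `Φ` of `exp^∗ Φ = Ψ` (for `Ψ(∅) = 1`), by recursion on the number of points:
the term of highest order in `(exp^∗ Φ)(η)` is `Φ(η)`, and the others, which contain `Φ` only on
proper subsets of `η`, are subtracted from `Ψ(η)`. -/
def starLog {d : ℕ} (Ψ : Finset (Space d) → ℝ) (η : Finset (Space d)) : ℝ :=
  Ψ η - starExp (fun γ => if _h : γ ⊂ η then starLog Ψ γ else 0) η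
termination_by η.card
decreasing_by exact Finset.card_lt_card _h

/-- The truncated correlation functions `ρ_T`, given by `ρ = exp^∗ ρ_T`. -/
def truncated {d : ℕ} (ρ : Finset (Space d) → ℝ) : Finset (Space d) → ℝ := starLog ρ

/-- `D_{x} ρ_T / ρ^(1)(x)`. -/
def normD {d : ℕ} (ρ : Finset (Space d) → ℝ) (x : Space d) (η : Finset (Space d)) : ℝ :=
  dOp {x} (truncated ρ) η / ρ {x}

/-- The family `ω_x`, given recursively by `D_{x} ρ_T / ρ^(1)(x) = exp^∗ ω_x`. -/
def omega1 {d : ℕ} (ρ : Finset (Space d) → ℝ) (x : Space d) : Finset (Space d) → ℝ :=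
  starLog (normD ρ x)

/-- The family `ω_{x₁,x₂}`, given recursively by
`D_{x₁,x₂} ρ_T / ρ^(2)(x₁,x₂) = (exp^∗ ω_{x₁,x₂} - (ρ^(1)(x₁) ρ^(1)(x₂) / ρ^(2)(x₁,x₂)) 𝟙)
  ∗ (D_{x₁} ρ_T / ρ^(1)(x₁)) ∗ (D_{x₂} ρ_T / ρ^(1)(x₂))`:
at `η`, the right-hand side is `ω_{x₁,x₂}(η)` plus terms with `ω_{x₁,x₂}` on proper subsets. -/
def omega2 {d : ℕ} (ρ : Finset (Space d) → ℝ) (x₁ x₂ : Space d) (η : Finset (Space d)) : ℝ :=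
  dOp {x₁, x₂} (truncated ρ) η / ρ {x₁, x₂} -
    starMul (starMul (fun ζ => starExp (fun γ => if _h : γ ⊂ η then omega2 ρ x₁ x₂ γ else 0) ζ -
      ρ {x₁} * ρ {x₂} / ρ {x₁, x₂} * starOne ζ) (normD ρ x₁)) (normD ρ x₂) η
termination_by η.card
decreasing_by exact Finset.card_lt_card _h

/-- The `k`-th term `((-1)^k / k!) ∫ F^(k)(y) dy` of the expansions. -/
def expansionTerm {d : ℕ} (F : Finset (Space d) → ℝ) (k : ℕ) : ℝ :=
  (-1) ^ k / (k.factorial : ℝ) * ∫ y : Fin k → Space d, atPoints F y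

/-! ### The three assumptions -/

/-- Limits of the ratios of Janossy densities: for `n = 1, 2` and all bounded `Δ`,
`j_Λ^(n)(x) / j_Λ^(0)` tends to `exp(n μ - H(x))`, uniformly in `x ∈ Δ^n`, as `Λ` increases to
`ℝ^d` along some sequence of bounded Borel sets. -/
def AssumptionA {d : ℕ} (μ : ℝ) (H : Finset (Space d) → EReal) (P : Measure (Configuration d)) :
    Prop :=
  ∃ Λ : ℕ → Set (Space d), Monotone Λ ∧ (∀ i, Bornology.IsBounded (Λ i)) ∧
    (∀ i, MeasurableSet (Λ i)) ∧ (⋃ i, Λ i) = Set.univ ∧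
    ∀ n : ℕ, n = 1 ∨ n = 2 → ∀ Δ : Set (Space d), Bornology.IsBounded Δ →
      TendstoUniformlyOn (fun (i : ℕ) (x : Finset (Space d)) =>
          janossy μ H P (Λ i) x / janossy μ H P (Λ i) ∅)
        (fun x => (EReal.exp (((n * μ : ℝ) : EReal) - H x)).toReal) atTop
        {x : Finset (Space d) | x.card = n ∧ (x : Set (Space d)) ⊆ Δ}

/-- Strong Brillinger mixing with constants `M`, `A`, `D`. -/
def AssumptionB {d : ℕ} (ρ : Finset (Space d) → ℝ) (M A D : ℝ) : Prop :=
  ∀ (Λ : Set (Space d)), MeasurableSet Λ → ∀ k : ℕ, 1 ≤ k →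
    ∀ x : Finset (Space d), x.card = 1 ∨ x.card = 2 →
      ∫⁻ y in Set.univ.pi (fun _ : Fin k => Λ), ‖atPoints (dOp x (truncated ρ)) y‖ₑ ≤
        ENNReal.ofReal (((x.card + k - 1).factorial : ℝ) * M * A ^ x.card * D ^ k *
          ∏ p ∈ x, ρ {p})

/-- Positivity of the density, and the lower bound on the pair correlation function at
distance at least `r`, with constant `dr`. -/
def AssumptionC {d : ℕ} (ρ : Finset (Space d) → ℝ) (r dr : ℝ) : Prop :=
  (∀ x : Space d, 0 < ρ {x}) ∧
    ∀ x₁ x₂ : Space d, r ≤ dist x₁ x₂ → ρ {x₁} * ρ {x₂} ≤ dr * ρ {x₁, x₂}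

end InverseGibbs

end

open InverseGibbs

/-! The functional `F ↦ ∑ₖ (-1)^k / k! ∫ F^(k)` is multiplicative for the product `∗`, hence maps
`exp^∗ ω` to the exponential of the expansion of `ω`. Inclusion–exclusion and the GNZ equation show
that its value at the restriction of `D_γ ρ` to the configurations in `Λ` is the Janossy density
`j_Λ(γ)`. The equations for `ω_x` and `ω_{x₁,x₂}` amount to the factorizations
`D_{x} ρ = ρ ∗ ρ^(1)(x) exp^∗ ω_x` and
`D_{x₁,x₂} ρ = ρ ∗ ρ^(2)(x₁,x₂) exp^∗ (ω_{x₁,x₂} + ω_{x₁} + ω_{x₂})`, away from `x` and `x₁, x₂`,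
so that `j_Λ(γ) / j_Λ(∅)` is `ρ(γ)` times the exponential of an expansion over `Λ`; let `Λ`
increase to `ℝ^d`. Absolute convergence: for small `D` the function `exp^∗ ω` is within `1/2` of the
unit in a weighted `L¹`-norm, and `K ω ∗ exp^∗ ω = K exp^∗ ω` for the number operator `K`, a
derivation of `∗`, which bounds the norm of `K ω`.
-/

noncomputable section

namespace InverseGibbs

variable {d : ℕ}

/-! ### The star algebra -/

section StarAlgebra

variable {F F' G G' : Finset (Space d) → ℝ} {η : Finset (Space d)}

theorem starMul_congr (hF : ∀ γ ⊆ η, F γ = F' γ) (hG : ∀ γ ⊆ η, G γ = G' γ) :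
    starMul F G η = starMul F' G' η :=
  Finset.sum_congr rfl fun γ hγ => by
    rw [hF γ (Finset.mem_powerset.1 hγ), hG _ Finset.sdiff_subset]

theorem starMul_comm (F G : Finset (Space d) → ℝ) : starMul F G = starMul G F := by
  funext η
  refine Finset.sum_nbij' (η \ ·) (η \ ·) (by simp) (by simp) ?_ ?_ ?_ <;> intro γ hγ <;>
    have hγη := Finset.mem_powerset.1 hγ
  · simpa using hγη
  · simpa using hγη
  · rw [Finset.sdiff_sdiff_eq_self hγη, mul_comm]

theorem starMul_assoc (F G K : Finset (Space d) → ℝ) :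
    starMul (starMul F G) K = starMul F (starMul G K) := by
  funext η
  simp only [starMul, Finset.sum_mul, Finset.mul_sum]
  rw [Finset.sum_sigma', Finset.sum_sigma']
  refine Finset.sum_nbij' (fun p => ⟨p.2, p.1 \ p.2⟩) (fun p => ⟨p.1 ∪ p.2, p.1⟩)
    ?_ ?_ ?_ ?_ ?_ <;> rintro ⟨γ, δ⟩ h <;> simp only [Finset.mem_sigma, Finset.mem_powerset] at h ⊢
  · exact ⟨h.2.trans h.1, Finset.sdiff_subset_sdiff h.1 subset_rfl⟩
  · exact ⟨Finset.union_subset h.1 (h.2.trans Finset.sdiff_subset), Finset.subset_union_left⟩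
  · rw [Finset.union_sdiff_of_subset h.2]
  · have hδγ : Disjoint δ γ := Finset.disjoint_of_subset_left h.2 Finset.sdiff_disjoint
    rw [Finset.union_sdiff_cancel_left hδγ.symm]
  · rw [sdiff_sdiff_left, Finset.sup_eq_union, Finset.union_sdiff_of_subset h.2, mul_assoc]

instance : Std.Commutative (starMul (d := d)) := ⟨starMul_comm⟩

instance : Std.Associative (starMul (d := d)) := ⟨starMul_assoc⟩

theorem starOne_starMul (F : Finset (Space d) → ℝ) : starMul starOne F = F := by
  funext η
  rw [starMul, Finset.sum_eq_single ∅] <;> simp +contextual [starOne]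

theorem starMul_starOne (F : Finset (Space d) → ℝ) : starMul F starOne = F := by
  rw [starMul_comm, starOne_starMul]

theorem starMul_empty (F G : Finset (Space d) → ℝ) : starMul F G ∅ = F ∅ * G ∅ := by
  simp [starMul]

theorem starMul_add_left (F F' G : Finset (Space d) → ℝ) :
    starMul (F + F') G = starMul F G + starMul F' G := by
  funext η
  simp [starMul, add_mul, Finset.sum_add_distrib]

theorem starMul_add_right (F G G' : Finset (Space d) → ℝ) :
    starMul F (G + G') = starMul F G + starMul F G' := by
  simp only [starMul_comm F, starMul_add_left]

theorem starMul_smul_left (c : ℝ) (F G : Finset (Space d) → ℝ) :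
    starMul (c • F) G = c • starMul F G := by
  funext η
  simp [starMul, Finset.mul_sum, mul_assoc]

theorem starMul_smul_right (c : ℝ) (F G : Finset (Space d) → ℝ) :
    starMul F (c • G) = c • starMul F G := by
  rw [starMul_comm, starMul_smul_left, starMul_comm]

theorem starMul_sub_left (F F' G : Finset (Space d) → ℝ) :
    starMul (F - F') G = starMul F G - starMul F' G := by
  funext η
  simp [starMul, sub_mul, Finset.sum_sub_distrib]

theorem starMul_sum_left {ι : Type*} (s : Finset ι) (F : ι → Finset (Space d) → ℝ)
    (G : Finset (Space d) → ℝ) : starMul (∑ i ∈ s, F i) G = ∑ i ∈ s, starMul (F i) G := by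
  funext η
  simp only [starMul, Finset.sum_apply, Finset.sum_mul]
  rw [Finset.sum_comm]

theorem starMul_sub_of_eq_ssubset (h : ∀ γ ⊂ η, F γ = F' γ) (G : Finset (Space d) → ℝ) :
    starMul F G η - starMul F' G η = (F η - F' η) * G ∅ := by
  rw [← Pi.sub_apply, ← starMul_sub_left, starMul, Finset.sum_eq_single η]
  · simp
  · intro γ hγ hne
    simp [h γ ((Finset.mem_powerset.1 hγ).ssubset_of_ne hne)]
  · simp

theorem starOne_of_nonempty (hη : η.Nonempty) : starOne η = 0 := if_neg hη.ne_empty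

theorem starPow_zero (F : Finset (Space d) → ℝ) : starPow F 0 = starOne := rfl

theorem starPow_one (F : Finset (Space d) → ℝ) : starPow F 1 = F := starMul_starOne F

theorem starPow_congr (n : ℕ) (h : ∀ γ ⊆ η, F γ = F' γ) : starPow F n η = starPow F' n η := by
  induction n generalizing η with
  | zero => rfl
  | succ n ih => exact starMul_congr h fun γ hγ => ih fun δ hδ => h δ (hδ.trans hγ)

theorem starPow_eq_zero_of_card_lt (h0 : F ∅ = 0) {n : ℕ} (hn : η.card < n) :
    starPow F n η = 0 := by
  induction n generalizing η with
  | zero => omega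
  | succ n ih =>
    refine Finset.sum_eq_zero fun γ hγ => ?_
    rcases γ.eq_empty_or_nonempty with rfl | hne
    · rw [h0, zero_mul]
    · have hγη := Finset.card_le_card (Finset.mem_powerset.1 hγ)
      have hpos := hne.card_pos
      rw [ih (by rw [Finset.card_sdiff_of_subset (Finset.mem_powerset.1 hγ)]; omega), mul_zero]

theorem starExp_eq_sum (h0 : F ∅ = 0) {N : ℕ} (hN : η.card < N) :
    starExp F η = (∑ n ∈ Finset.range N, ((n.factorial : ℝ))⁻¹ • starPow F n) η := by
  rw [Finset.sum_apply]
  refine tsum_eq_sum fun n hn => ?_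
  rw [starPow_eq_zero_of_card_lt h0 (hN.trans_le (by simpa using hn)), mul_zero]

theorem starExp_congr (h : ∀ γ ⊆ η, F γ = F' γ) : starExp F η = starExp F' η := by
  simp only [starExp, starPow_congr _ h]

theorem starExp_empty (h0 : F ∅ = 0) : starExp F ∅ = 1 := by
  rw [starExp_eq_sum h0 (N := 1) (by simp)]
  simp [starPow, starOne]

end StarAlgebra

/-! ### The star logarithm -/

section StarLog

variable {F : Finset (Space d) → ℝ} {η : Finset (Space d)}

/-- The restriction of `F` to the proper subsets of `η`, on which the recursions for `starLog` and
`omega2` at `η` rest. -/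
def properPart (F : Finset (Space d) → ℝ) (η γ : Finset (Space d)) : ℝ :=
  if γ ⊂ η then F γ else 0

theorem properPart_of_ssubset {γ : Finset (Space d)} (h : γ ⊂ η) : properPart F η γ = F γ :=
  if_pos h

theorem properPart_self : properPart F η η = 0 := if_neg (ssubset_irrefl η)

theorem properPart_empty (h0 : F ∅ = 0) : properPart F η ∅ = 0 := by simp [properPart, h0]

theorem starExp_properPart_of_ssubset {γ : Finset (Space d)} (h : γ ⊂ η) :
    starExp (properPart F η) γ = starExp F γ :=
  starExp_congr fun _ hδ => properPart_of_ssubset (hδ.trans_ssubset h)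

theorem starPow_add_two_properPart (h0 : F ∅ = 0) (n : ℕ) :
    starPow (properPart F η) (n + 2) η = starPow F (n + 2) η := by
  refine Finset.sum_congr rfl fun γ hγ => ?_
  have hγη := Finset.mem_powerset.1 hγ
  rcases γ.eq_empty_or_nonempty with rfl | hne
  · rw [properPart_empty h0, h0, zero_mul, zero_mul]
  rcases hγη.eq_or_ssubset with rfl | hss
  · rw [Finset.sdiff_self, starPow_eq_zero_of_card_lt h0 (by simp),
      starPow_eq_zero_of_card_lt (properPart_empty h0) (by simp), mul_zero, mul_zero]
  · rw [properPart_of_ssubset hss, starPow_congr (n + 1) fun δ hδ =>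
      properPart_of_ssubset (hδ.trans_ssubset (Finset.sdiff_ssubset hγη hne))]

theorem starExp_eq_add_properPart (h0 : F ∅ = 0) (hη : η.Nonempty) :
    starExp F η = F η + starExp (properPart F η) η := by
  have hc : η.card < η.card + 2 := by omega
  rw [starExp_eq_sum h0 hc, starExp_eq_sum (properPart_empty h0) hc]
  simp only [Finset.sum_range_succ', Finset.sum_apply, Pi.smul_apply, add_assoc,
    Nat.reduceAdd, starPow_add_two_properPart h0, starPow_one, zero_add, properPart_self,
    starPow_zero, starOne_of_nonempty hη, Nat.factorial_one, Nat.cast_one, inv_one, one_smul,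
    smul_zero, add_zero]
  ring

theorem starLog_eq (F : Finset (Space d) → ℝ) (η : Finset (Space d)) :
    starLog F η = F η - starExp (properPart (starLog F) η) η := by
  rw [starLog]
  congr 2

theorem starLog_empty (h1 : F ∅ = 1) : starLog F ∅ = 0 := by
  rw [starLog_eq, starExp_empty (by simp [properPart]), h1, sub_self]

theorem starExp_starLog (h1 : F ∅ = 1) : starExp (starLog F) = F := by
  funext η
  rcases η.eq_empty_or_nonempty with rfl | hne
  · rw [starExp_empty (starLog_empty h1), h1]
  · rw [starExp_eq_add_properPart (starLog_empty h1) hne, starLog_eq F η, sub_add_cancel]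

end StarLog

/-! ### Derivations of the star algebra -/

section Derivations

variable {F F' G G' : Finset (Space d) → ℝ} {x : Space d} {Z η : Finset (Space d)}

/-- Equality of two functions on the finite configurations without points in the finite set `Z`. -/
def EqOff (Z : Finset (Space d)) (F G : Finset (Space d) → ℝ) : Prop :=
  ∀ η, Disjoint η Z → F η = G η

theorem EqOff.of_eq (h : F = G) : EqOff Z F G := fun _ _ => congrFun h _

theorem EqOff.trans (h : EqOff Z F F') (h' : EqOff Z F' G) : EqOff Z F G :=
  fun η hη => (h η hη).trans (h' η hη)

theorem EqOff.mono {Z' : Finset (Space d)} (hZ : Z ⊆ Z') (h : EqOff Z F G) : EqOff Z' F G :=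
  fun _ hη => h _ (hη.mono_right hZ)

theorem EqOff.add (hF : EqOff Z F F') (hG : EqOff Z G G') : EqOff Z (F + G) (F' + G') :=
  fun η hη => congrArg₂ (· + ·) (hF η hη) (hG η hη)

theorem EqOff.starMul (hF : EqOff Z F F') (hG : EqOff Z G G') :
    EqOff Z (starMul F G) (starMul F' G') := fun _ hη =>
  starMul_congr (fun γ hγ => hF γ (hη.mono_left hγ)) fun γ hγ => hG γ (hη.mono_left hγ)

theorem EqOff.dOp {γ : Finset (Space d)} (hγ : Disjoint γ Z) (h : EqOff Z F G) :
    EqOff Z (dOp γ F) (dOp γ G) := fun η hη => by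
  simp only [InverseGibbs.dOp, h (η ∪ γ) (Finset.disjoint_union_left.2 ⟨hη, hγ⟩)]

theorem dOp_apply_empty (γ : Finset (Space d)) (F : Finset (Space d) → ℝ) : dOp γ F ∅ = F γ := by
  simp [dOp]

theorem dOp_empty (F : Finset (Space d) → ℝ) : dOp ∅ F = F := by
  funext η
  simp [dOp]

theorem dOp_singleton_apply (hx : x ∉ η) (F : Finset (Space d) → ℝ) :
    dOp {x} F η = F (insert x η) := by
  rw [dOp, if_pos (by simpa using hx), Finset.union_comm, Finset.insert_eq]

theorem dOp_add (γ : Finset (Space d)) (F G : Finset (Space d) → ℝ) :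
    dOp γ (F + G) = dOp γ F + dOp γ G := by
  funext η
  simp only [dOp, Pi.add_apply]
  split_ifs <;> simp

theorem dOp_dOp {γ δ : Finset (Space d)} (h : Disjoint γ δ) (F : Finset (Space d) → ℝ) :
    dOp γ (dOp δ F) = dOp (γ ∪ δ) F := by
  funext η
  simp only [dOp, Finset.disjoint_union_left, Finset.disjoint_union_right, h, and_true,
    Finset.union_assoc, ite_and]

theorem starMul_insert (hx : x ∉ η) (F G : Finset (Space d) → ℝ) :
    starMul F G (insert x η) = starMul (dOp {x} F) G η + starMul F (dOp {x} G) η := by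
  rw [starMul, Finset.sum_powerset_insert hx, add_comm]
  congr 1 <;> refine Finset.sum_congr rfl fun γ hγ => ?_ <;>
    have hxγ : x ∉ γ := fun h => hx (Finset.mem_powerset.1 hγ h)
  · rw [dOp_singleton_apply hxγ, Finset.insert_sdiff_insert, Finset.sdiff_insert_of_notMem hx]
  · rw [dOp_singleton_apply (fun h => hx (Finset.sdiff_subset h)),
      Finset.insert_sdiff_of_notMem _ hxγ]

theorem dOp_starMul (x : Space d) (F G : Finset (Space d) → ℝ) :
    EqOff {x} (dOp {x} (starMul F G)) (starMul (dOp {x} F) G + starMul F (dOp {x} G)) :=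
  fun η hη => by
    have hx : x ∉ η := by simpa using hη
    rw [dOp_singleton_apply hx, starMul_insert hx, Pi.add_apply]

theorem dOp_starPow (x : Space d) (F : Finset (Space d) → ℝ) (n : ℕ) :
    EqOff {x} (dOp {x} (starPow F (n + 1)))
      (((n : ℝ) + 1) • starMul (starPow F n) (dOp {x} F)) := by
  induction n with
  | zero => exact .of_eq (by simp only [zero_add, starPow_one, starPow_zero,
      starOne_starMul, Nat.cast_zero, one_smul])
  | succ n ih =>
    refine (dOp_starMul x F _).trans <| (EqOff.add (.of_eq rfl) (.starMul (.of_eq rfl) ih)).trans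
      (.of_eq ?_)
    have hF : starMul F (starMul (starPow F n) (dOp {x} F)) =
        starMul (starPow F (n + 1)) (dOp {x} F) := (starMul_assoc _ _ _).symm
    rw [starMul_smul_right, hF, starMul_comm (dOp {x} F)]
    push_cast
    module

theorem starExp_insert (hx : x ∉ η) (h0 : F ∅ = 0) :
    starExp F (insert x η) = starMul (starExp F) (dOp {x} F) η := by
  have hc : (insert x η).card < η.card + 1 + 1 := by rw [Finset.card_insert_of_notMem hx]; omega
  have hpow (n : ℕ) : starPow F (n + 1) (insert x η) =
      (n + 1) * starMul (starPow F n) (dOp {x} F) η := by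
    rw [← dOp_singleton_apply hx (starPow F _), dOp_starPow x F n η (by simpa using hx)]
    rfl
  rw [starExp_eq_sum h0 hc, starMul_congr
    (fun γ hγ => starExp_eq_sum h0 (Nat.lt_succ_of_le (Finset.card_le_card hγ)))
    (fun _ _ => rfl), starMul_sum_left, Finset.sum_apply, Finset.sum_range_succ', Finset.sum_apply]
  simp only [starMul_smul_left, Pi.smul_apply, hpow, starPow_zero,
    starOne_of_nonempty (Finset.insert_nonempty x η), smul_eq_mul, mul_zero, add_zero]
  refine Finset.sum_congr rfl fun n _ => ?_
  rw [Nat.factorial_succ]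
  push_cast
  field_simp

theorem dOp_starExp (h0 : F ∅ = 0) (x : Space d) :
    EqOff {x} (dOp {x} (starExp F)) (starMul (starExp F) (dOp {x} F)) := fun η hη => by
  have hx : x ∉ η := by simpa using hη
  rw [dOp_singleton_apply hx, starExp_insert hx h0]

theorem eq_starExp_of_dOp {E : Finset (Space d) → ℝ} (h0 : F ∅ = 0) (hE : E ∅ = 1)
    (h : ∀ x, EqOff {x} (dOp {x} E) (starMul E (dOp {x} F))) : E = starExp F := by
  funext η
  induction η using Finset.strongInduction with
  | H η ih =>
    rcases η.eq_empty_or_nonempty with rfl | ⟨x, hxη⟩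
    · rw [hE, starExp_empty h0]
    obtain ⟨ζ, hx, rfl⟩ : ∃ ζ, x ∉ ζ ∧ insert x ζ = η :=
      ⟨η.erase x, Finset.notMem_erase _ _, Finset.insert_erase hxη⟩
    rw [← dOp_singleton_apply hx E, h x ζ (by simpa using hx), starExp_insert hx h0]
    exact starMul_congr (fun γ hγ => ih γ (hγ.trans_ssubset (Finset.ssubset_insert hx)))
      fun _ _ => rfl

theorem starExp_add (hF : F ∅ = 0) (hG : G ∅ = 0) :
    starExp (F + G) = starMul (starExp F) (starExp G) := by
  refine (eq_starExp_of_dOp (by simp [hF, hG]) ?_ fun x => ?_).symm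
  · rw [starMul_empty, starExp_empty hF, starExp_empty hG, one_mul]
  · refine (dOp_starMul x _ _).trans <| (EqOff.add ((dOp_starExp hF x).starMul (.of_eq rfl))
      (EqOff.starMul (.of_eq rfl) (dOp_starExp hG x))).trans (.of_eq ?_)
    rw [dOp_add, starMul_add_right]
    congr 1 <;> ac_rfl

/-- The number operator `(K F)(η) = #η F(η)`, a derivation of the star algebra. -/
def numberOp (F : Finset (Space d) → ℝ) (η : Finset (Space d)) : ℝ := η.card * F η

theorem starExp_eq_sum_mem (h0 : F ∅ = 0) (hx : x ∈ η) :
    starExp F η = ∑ γ ∈ η.powerset, if x ∈ γ then F γ * starExp F (η \ γ) else 0 := by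
  obtain ⟨ζ, hxζ, rfl⟩ : ∃ ζ, x ∉ ζ ∧ insert x ζ = η :=
    ⟨η.erase x, Finset.notMem_erase _ _, Finset.insert_erase hx⟩
  have hx_notMem {γ : Finset (Space d)} (hγ : γ ∈ ζ.powerset) : x ∉ γ :=
    fun h => hxζ (Finset.mem_powerset.1 hγ h)
  rw [Finset.sum_powerset_insert hxζ, Finset.sum_eq_zero fun γ hγ => if_neg (hx_notMem hγ),
    zero_add, starExp_insert hxζ h0, starMul_comm]
  refine Finset.sum_congr rfl fun γ hγ => ?_
  rw [if_pos (Finset.mem_insert_self _ _), dOp_singleton_apply (hx_notMem hγ),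
    Finset.insert_sdiff_insert, Finset.sdiff_insert_of_notMem hxζ]

theorem numberOp_starExp (h0 : F ∅ = 0) :
    numberOp (starExp F) = starMul (numberOp F) (starExp F) := by
  funext η
  calc numberOp (starExp F) η
      = ∑ x ∈ η, ∑ γ ∈ η.powerset, if x ∈ γ then F γ * starExp F (η \ γ) else 0 := by
        rw [← Finset.sum_congr rfl fun x hx => starExp_eq_sum_mem h0 hx]
        simp [numberOp]
    _ = ∑ γ ∈ η.powerset, ∑ x ∈ η, if x ∈ γ then F γ * starExp F (η \ γ) else 0 :=
        Finset.sum_comm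
    _ = starMul (numberOp F) (starExp F) η := Finset.sum_congr rfl fun γ hγ => by
        rw [← Finset.sum_filter, Finset.filter_mem_eq_inter,
          Finset.inter_eq_right.2 (Finset.mem_powerset.1 hγ), Finset.sum_const, nsmul_eq_mul,
          numberOp, mul_assoc]

end Derivations

/-! ### Truncated correlation functions and the functions `ω` -/

section Recursions

variable {ρ : Finset (Space d) → ℝ} {x x₁ x₂ : Space d}

theorem truncated_empty (h : ρ ∅ = 1) : truncated ρ ∅ = 0 := starLog_empty h

theorem starExp_truncated (h : ρ ∅ = 1) : starExp (truncated ρ) = ρ := starExp_starLog h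

theorem dOp_singleton_eq_starMul (h : ρ ∅ = 1) (x : Space d) :
    EqOff {x} (dOp {x} ρ) (starMul ρ (dOp {x} (truncated ρ))) := by
  simpa only [starExp_truncated h] using dOp_starExp (truncated_empty h) x

theorem dOp_pair_eq_starMul (h : ρ ∅ = 1) (h12 : x₁ ≠ x₂) :
    EqOff {x₁, x₂} (dOp {x₁, x₂} ρ) (starMul ρ
      (starMul (dOp {x₁} (truncated ρ)) (dOp {x₂} (truncated ρ)) +
        dOp {x₁, x₂} (truncated ρ))) := by
  have hdisj : Disjoint ({x₁} : Finset (Space d)) {x₂} := by simpa using h12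
  have hpair (F : Finset (Space d) → ℝ) : dOp {x₁, x₂} F = dOp {x₁} (dOp {x₂} F) := by
    rw [dOp_dOp hdisj, Finset.insert_eq]
  have hx₁ : EqOff {x₁, x₂} (dOp {x₁} ρ) (starMul ρ (dOp {x₁} (truncated ρ))) :=
    (dOp_singleton_eq_starMul h x₁).mono (by simp)
  rw [hpair ρ, hpair (truncated ρ)]
  intro η hη
  calc dOp {x₁} (dOp {x₂} ρ) η
      = dOp {x₁} (starMul ρ (dOp {x₂} (truncated ρ))) η :=
        (dOp_singleton_eq_starMul h x₂).dOp hdisj η (hη.mono_right (by simp))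
    _ = (starMul (dOp {x₁} ρ) (dOp {x₂} (truncated ρ)) +
          starMul ρ (dOp {x₁} (dOp {x₂} (truncated ρ)))) η :=
        dOp_starMul x₁ _ _ η (hη.mono_right (by simp))
    _ = (starMul (starMul ρ (dOp {x₁} (truncated ρ))) (dOp {x₂} (truncated ρ)) +
          starMul ρ (dOp {x₁} (dOp {x₂} (truncated ρ)))) η :=
        (hx₁.starMul (.of_eq rfl)).add (.of_eq rfl) η hη
    _ = _ := by rw [starMul_add_right, starMul_assoc]

theorem truncated_singleton (h : ρ ∅ = 1) (x : Space d) : truncated ρ {x} = ρ {x} := by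
  simpa [dOp_apply_empty, starMul_empty, h] using
    (dOp_singleton_eq_starMul h x ∅ (Finset.disjoint_empty_left _)).symm

theorem truncated_pair (h : ρ ∅ = 1) (h12 : x₁ ≠ x₂) :
    truncated ρ {x₁, x₂} = ρ {x₁, x₂} - ρ {x₁} * ρ {x₂} := by
  have hρ := dOp_pair_eq_starMul h h12 ∅ (Finset.disjoint_empty_left _)
  simp only [dOp_apply_empty, starMul_empty, Pi.add_apply, h, truncated_singleton h] at hρ
  linarith

theorem normD_eq_smul (ρ : Finset (Space d) → ℝ) (x : Space d) :
    normD ρ x = (ρ {x})⁻¹ • dOp {x} (truncated ρ) := by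
  funext η
  rw [normD, div_eq_inv_mul, Pi.smul_apply, smul_eq_mul]

theorem smul_normD (hx : ρ {x} ≠ 0) : ρ {x} • normD ρ x = dOp {x} (truncated ρ) := by
  rw [normD_eq_smul, smul_inv_smul₀ hx]

theorem normD_empty (h : ρ ∅ = 1) (hx : ρ {x} ≠ 0) : normD ρ x ∅ = 1 := by
  rw [normD, dOp_apply_empty, truncated_singleton h, div_self hx]

theorem omega1_empty (h : ρ ∅ = 1) (hx : ρ {x} ≠ 0) : omega1 ρ x ∅ = 0 :=
  starLog_empty (normD_empty h hx)

theorem starExp_omega1 (h : ρ ∅ = 1) (hx : ρ {x} ≠ 0) : starExp (omega1 ρ x) = normD ρ x :=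
  starExp_starLog (normD_empty h hx)

/-- `D_{x₁,x₂} ρ_T / ρ^(2)(x₁,x₂)`, the left-hand side of the equation for `ω_{x₁,x₂}`. -/
def normD₂ (ρ : Finset (Space d) → ℝ) (x₁ x₂ : Space d) : Finset (Space d) → ℝ :=
  (ρ {x₁, x₂})⁻¹ • dOp {x₁, x₂} (truncated ρ)

/-- `ρ^(1)(x₁) ρ^(1)(x₂) / ρ^(2)(x₁,x₂)`, the inverse of the pair correlation function. -/
def invPairCorr (ρ : Finset (Space d) → ℝ) (x₁ x₂ : Space d) : ℝ :=
  ρ {x₁} * ρ {x₂} / ρ {x₁, x₂}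

theorem normD₂_empty (h : ρ ∅ = 1) (h12 : x₁ ≠ x₂) (hx : ρ {x₁, x₂} ≠ 0) :
    normD₂ ρ x₁ x₂ ∅ = 1 - invPairCorr ρ x₁ x₂ := by
  rw [normD₂, Pi.smul_apply, dOp_apply_empty, truncated_pair h h12, invPairCorr, smul_eq_mul]
  field_simp

theorem omega2_eq (x₁ x₂ : Space d) (η : Finset (Space d)) :
    omega2 ρ x₁ x₂ η = normD₂ ρ x₁ x₂ η -
      starMul (starMul (starExp (properPart (omega2 ρ x₁ x₂) η) -
        invPairCorr ρ x₁ x₂ • starOne) (normD ρ x₁)) (normD ρ x₂) η := by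
  rw [omega2, div_eq_inv_mul]
  rfl

theorem omega2_empty (h : ρ ∅ = 1) (h12 : x₁ ≠ x₂) (hx₁ : ρ {x₁} ≠ 0) (hx₂ : ρ {x₂} ≠ 0)
    (hx : ρ {x₁, x₂} ≠ 0) : omega2 ρ x₁ x₂ ∅ = 0 := by
  rw [omega2_eq, starMul_empty, starMul_empty, normD_empty h hx₁, normD_empty h hx₂,
    normD₂_empty h h12 hx, Pi.sub_apply, starExp_empty (by simp [properPart])]
  simp [starOne]

theorem normD₂_eq_starMul (h : ρ ∅ = 1) (h12 : x₁ ≠ x₂) (hx₁ : ρ {x₁} ≠ 0) (hx₂ : ρ {x₂} ≠ 0)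
    (hx : ρ {x₁, x₂} ≠ 0) :
    normD₂ ρ x₁ x₂ = starMul (starMul (starExp (omega2 ρ x₁ x₂) - invPairCorr ρ x₁ x₂ • starOne)
      (normD ρ x₁)) (normD ρ x₂) := by
  funext η
  have h0 := omega2_empty h h12 hx₁ hx₂ hx
  set E := starExp (omega2 ρ x₁ x₂) - invPairCorr ρ x₁ x₂ • starOne
  set E' := starExp (properPart (omega2 ρ x₁ x₂) η) - invPairCorr ρ x₁ x₂ • starOne
  have hEE' : ∀ γ ⊂ η, E γ = E' γ := fun γ hγ => by
    simp only [E, E', Pi.sub_apply, starExp_properPart_of_ssubset hγ]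
  have hη : E η - E' η = omega2 ρ x₁ x₂ η := by
    simp only [E, E', Pi.sub_apply, sub_sub_sub_cancel_right]
    rcases η.eq_empty_or_nonempty with rfl | hne
    · rw [starExp_empty h0, starExp_empty (properPart_empty h0), h0, sub_self]
    · rw [starExp_eq_add_properPart h0 hne, add_sub_cancel_right]
  have hN₁ := starMul_sub_of_eq_ssubset hEE' (normD ρ x₁)
  have hN₂ := starMul_sub_of_eq_ssubset (fun γ hγ =>
    starMul_congr (fun δ hδ => hEE' δ (hδ.trans_ssubset hγ)) fun _ _ => rfl :
      ∀ γ ⊂ η, starMul E (normD ρ x₁) γ = starMul E' (normD ρ x₁) γ) (normD ρ x₂)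
  rw [hN₁, hη, normD_empty h hx₁, normD_empty h hx₂, mul_one, mul_one] at hN₂
  rw [eq_add_of_sub_eq' hN₂, omega2_eq, add_sub_cancel]

theorem dOp_singleton_eq_starExp (h : ρ ∅ = 1) (hx : ρ {x} ≠ 0) :
    EqOff {x} (dOp {x} ρ) (starMul ρ (ρ {x} • starExp (omega1 ρ x))) := by
  rw [starExp_omega1 h hx, smul_normD hx]
  exact dOp_singleton_eq_starMul h x

theorem dOp_pair_eq_starExp (h : ρ ∅ = 1) (h12 : x₁ ≠ x₂) (hx₁ : ρ {x₁} ≠ 0) (hx₂ : ρ {x₂} ≠ 0)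
    (hx : ρ {x₁, x₂} ≠ 0) :
    EqOff {x₁, x₂} (dOp {x₁, x₂} ρ) (starMul ρ
      (ρ {x₁, x₂} • starExp (omega2 ρ x₁ x₂ + (omega1 ρ x₁ + omega1 ρ x₂)))) := by
  refine (dOp_pair_eq_starMul h h12).trans (.of_eq (congrArg _ ?_))
  have h₁ := omega1_empty h hx₁
  have h₂ := omega1_empty h hx₂
  have hinv : ρ {x₁, x₂} * invPairCorr ρ x₁ x₂ = ρ {x₁} * ρ {x₂} := mul_div_cancel₀ _ hx
  have hT₂ : dOp {x₁, x₂} (truncated ρ) = ρ {x₁, x₂} • normD₂ ρ x₁ x₂ :=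
    (smul_inv_smul₀ hx _).symm
  rw [starExp_add (omega2_empty h h12 hx₁ hx₂ hx) (by simp [h₁, h₂]), starExp_add h₁ h₂,
    starExp_omega1 h hx₁, starExp_omega1 h hx₂, hT₂, ← smul_normD hx₁, ← smul_normD hx₂,
    normD₂_eq_starMul h h12 hx₁ hx₂ hx, starMul_sub_left, starMul_sub_left, starMul_smul_left,
    starMul_smul_left, starMul_smul_left, starMul_smul_right, starOne_starMul, starMul_assoc,
    smul_sub, smul_smul, smul_smul, hinv, add_sub_cancel]

theorem AssumptionC.pair_pos {r dr : ℝ} (hC : AssumptionC ρ r dr) (hρ : ∀ η, 0 ≤ ρ η)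
    (hr : r ≤ dist x₁ x₂) : 0 < ρ {x₁, x₂} :=
  (hρ _).lt_of_ne' fun h0 => (mul_pos (hC.1 x₁) (hC.1 x₂)).not_ge <| by
    simpa only [h0, mul_zero] using hC.2 x₁ x₂ hr

theorem AssumptionC.invPairCorr_le {r dr : ℝ} (hC : AssumptionC ρ r dr) (hρ : ∀ η, 0 ≤ ρ η)
    (hr : r ≤ dist x₁ x₂) : invPairCorr ρ x₁ x₂ ≤ dr :=
  (div_le_iff₀ (hC.pair_pos hρ hr)).2 (hC.2 x₁ x₂ hr)

end Recursions

/-! ### Integrals of functions on finite configurations -/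

section Integrals

variable {F G : Finset (Space d) → ℝ}

theorem nontrivial_space (hd : 1 ≤ d) : Nontrivial (Space d) := by
  have : Nonempty (Fin d) := ⟨⟨0, hd⟩⟩
  infer_instance

theorem ae_apply_ne [Nontrivial (Space d)] {k : ℕ} {i j : Fin k} (hij : i ≠ j) :
    ∀ᵐ y : Fin k → Space d, y i ≠ y j := by
  let S : Submodule ℝ (Fin k → Space d) :=
    LinearMap.ker (LinearMap.proj (R := ℝ) (φ := fun _ : Fin k => Space d) i -
      LinearMap.proj (R := ℝ) (φ := fun _ : Fin k => Space d) j)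
  have hS : S ≠ ⊤ := fun htop => by
    obtain ⟨v, hv⟩ := exists_ne (0 : Space d)
    have : (Pi.single i v : Fin k → Space d) ∈ S := htop ▸ Submodule.mem_top
    simp [S, hij.symm, hv] at this
  rw [ae_iff]
  convert Measure.addHaar_submodule (volume : Measure (Fin k → Space d)) S hS using 2
  ext y
  simp [S, sub_eq_zero]

theorem ae_injective [Nontrivial (Space d)] (k : ℕ) :
    ∀ᵐ y : Fin k → Space d, Function.Injective y := by
  have h : ∀ᵐ y : Fin k → Space d, ∀ i j, i ≠ j → y i ≠ y j :=
    ae_all_iff.2 fun _ => ae_all_iff.2 fun _ => Filter.eventually_imp_distrib_left.2 ae_apply_ne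
  filter_upwards [h] with y hy i j hij using not_imp_not.1 (hy i j) hij

theorem ae_disjoint_finset [Nontrivial (Space d)] (Z : Finset (Space d)) (k : ℕ) :
    ∀ᵐ y : Fin k → Space d, Disjoint (Finset.univ.image y) Z := by
  have h : ∀ᵐ y : Fin k → Space d, ∀ z ∈ Z, ∀ i, y i ≠ z := by
    refine (Finset.eventually_all Z).2 fun z _ => ae_all_iff.2 fun i => ?_
    simpa [ae_iff, volume_pi] using
      Measure.pi_hyperplane (fun _ : Fin k => (volume : Measure (Space d))) i z
  filter_upwards [h] with y hy
  simpa [Finset.disjoint_left] using fun i hi => hy _ hi i rfl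

theorem EqOff.ae_eq [Nontrivial (Space d)] {Z : Finset (Space d)} (h : EqOff Z F G) (k : ℕ) :
    (fun y : Fin k → Space d => atPoints F y) =ᵐ[volume] fun y => atPoints G y := by
  filter_upwards [ae_disjoint_finset Z k] with y hy using h _ hy

/-- Measurability of a function on finite configurations, up to null sets, in each number of
points separately. -/
def AEMeas (F : Finset (Space d) → ℝ) : Prop :=
  ∀ k, AEStronglyMeasurable (fun y : Fin k → Space d => atPoints F y) volume

protected theorem AEMeas.add (hF : AEMeas F) (hG : AEMeas G) : AEMeas (F + G) :=
  fun k => (hF k).add (hG k)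

theorem AEMeas.const_smul (hF : AEMeas F) (c : ℝ) : AEMeas (c • F) :=
  fun k => (hF k).const_smul c

theorem AEMeas.congr_eqOff [Nontrivial (Space d)] {Z : Finset (Space d)} (hF : AEMeas F)
    (h : EqOff Z F G) : AEMeas G :=
  fun k => (hF k).congr (h.ae_eq k)

theorem aemeas_starOne : AEMeas (starOne (d := d)) := by
  rintro (_ | k)
  · exact StronglyMeasurable.of_discrete.aestronglyMeasurable
  · have : (fun y : Fin (k + 1) → Space d => atPoints starOne y) = fun _ => 0 := by
      ext y
      simp [atPoints, starOne, Finset.image_eq_empty, Finset.univ_eq_empty_iff]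
    rw [this]
    exact aestronglyMeasurable_const

/-- The absolute counterpart `(1 / k!) ∫ |F^(k)|` of `expansionTerm`. -/
def absTerm (F : Finset (Space d) → ℝ) (k : ℕ) : ℝ≥0∞ :=
  ENNReal.ofReal (k.factorial : ℝ)⁻¹ * ∫⁻ y : Fin k → Space d, ‖atPoints F y‖ₑ

theorem EqOff.absTerm_eq [Nontrivial (Space d)] {Z : Finset (Space d)} (h : EqOff Z F G) (k : ℕ) :
    absTerm F k = absTerm G k := by
  exact congrArg _ (lintegral_congr_ae ((h.ae_eq k).mono fun _ => congrArg _))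

theorem EqOff.expansionTerm_eq [Nontrivial (Space d)] {Z : Finset (Space d)} (h : EqOff Z F G)
    (k : ℕ) : expansionTerm F k = expansionTerm G k := by
  rw [expansionTerm, expansionTerm, integral_congr_ae (h.ae_eq k)]

theorem card_image_univ {k : ℕ} {y : Fin k → Space d} (hy : Function.Injective y) :
    (Finset.univ.image y).card = k := by
  rw [Finset.card_image_of_injective _ hy, Finset.card_univ, Fintype.card_fin]

theorem absTerm_zero (F : Finset (Space d) → ℝ) : absTerm F 0 = ‖F ∅‖ₑ := by
  simp [absTerm, lintegral_unique, volume_pi, atPoints]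

theorem expansionTerm_zero (F : Finset (Space d) → ℝ) : expansionTerm F 0 = F ∅ := by
  simp [expansionTerm, integral_unique, measureReal_def, volume_pi, atPoints]

theorem enorm_expansionTerm_le (F : Finset (Space d) → ℝ) (k : ℕ) :
    ‖expansionTerm F k‖ₑ ≤ absTerm F k := by
  have : ‖(-1 : ℝ) ^ k / k.factorial‖ₑ = ENNReal.ofReal (k.factorial : ℝ)⁻¹ := by
    rw [Real.enorm_eq_ofReal_abs, abs_div, abs_pow]
    simp
  rw [expansionTerm, absTerm, enorm_mul, this]
  gcongr
  exact enorm_integral_le_lintegral_enorm _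

theorem integrable_atPoints (hF : AEMeas F) {k : ℕ} (h : absTerm F k ≠ ∞) :
    Integrable (fun y : Fin k → Space d => atPoints F y) := by
  refine ⟨hF k, hasFiniteIntegral_iff_enorm.2 (lt_top_iff_ne_top.2 fun h' => h ?_)⟩
  rw [absTerm, h', ENNReal.mul_top]
  exact (ENNReal.ofReal_pos.2 (by positivity)).ne'

/-- The measurable equivalence that separates the coordinates in `S` from those outside `S`. It
turns the sum over subconfigurations in `starMul` into a sum of products on product spaces. -/
def splitEquiv {k : ℕ} (S : Finset (Fin k)) :
    (Fin k → Space d) ≃ᵐ (Fin S.card → Space d) × (Fin (k - S.card) → Space d) :=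
  (MeasurableEquiv.piCongrLeft (fun _ => Space d)
    (finSumEquivOfFinset (s := S) (m := S.card) (n := k - S.card) rfl
      (by rw [Finset.card_compl, Fintype.card_fin]))).symm.trans
    (MeasurableEquiv.sumPiEquivProdPi fun _ => Space d)

theorem measurePreserving_splitEquiv {k : ℕ} (S : Finset (Fin k)) :
    MeasurePreserving (splitEquiv (d := d) S) volume (volume.prod volume) :=
  ((volume_measurePreserving_piCongrLeft (fun _ => Space d) _).symm).trans
    (volume_measurePreserving_sumPiEquivProdPi fun _ => Space d)

theorem image_splitEquiv_fst {k : ℕ} (S : Finset (Fin k)) (y : Fin k → Space d) :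
    Finset.univ.image (splitEquiv S y).1 = S.image y := by
  have : (splitEquiv S y).1 = y ∘ S.orderEmbOfFin rfl := rfl
  rw [this, ← Finset.image_image, Finset.image_orderEmbOfFin_univ]

theorem image_splitEquiv_snd {k : ℕ} (S : Finset (Fin k)) (y : Fin k → Space d) :
    Finset.univ.image (splitEquiv S y).2 = Sᶜ.image y := by
  have : (splitEquiv S y).2 = y ∘ Sᶜ.orderEmbOfFin
    (by rw [Finset.card_compl, Fintype.card_fin]) := rfl
  rw [this, ← Finset.image_image, Finset.image_orderEmbOfFin_univ]

/-- The summand of `(Ψ ∗ Φ)^(k)` given by the points with indices in `S`. -/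
def splitMul (Ψ Φ : Finset (Space d) → ℝ) {k : ℕ} (S : Finset (Fin k)) (y : Fin k → Space d) : ℝ :=
  atPoints Ψ (splitEquiv S y).1 * atPoints Φ (splitEquiv S y).2

theorem ae_atPoints_starMul [Nontrivial (Space d)] (Ψ Φ : Finset (Space d) → ℝ) (k : ℕ) :
    (fun y : Fin k → Space d => atPoints (starMul Ψ Φ) y) =ᵐ[volume] fun y =>
      ∑ S : Finset (Fin k), splitMul Ψ Φ S y := by
  filter_upwards [ae_injective k] with y hy
  simp only [splitMul, atPoints, image_splitEquiv_fst, image_splitEquiv_snd]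
  rw [starMul, Finset.powerset_image,
    Finset.sum_image fun S _ T _ h => Finset.image_injective hy h, Finset.powerset_univ]
  refine Finset.sum_congr rfl fun S _ => ?_
  rw [Finset.compl_eq_univ_sdiff, Finset.image_sdiff _ _ hy]

variable {Ψ Φ : Finset (Space d) → ℝ}

theorem aestronglyMeasurable_splitMul (hΨ : AEMeas Ψ) (hΦ : AEMeas Φ) {k : ℕ}
    (S : Finset (Fin k)) : AEStronglyMeasurable (splitMul Ψ Φ S) volume :=
  ((hΨ _).comp_fst.mul (hΦ _).comp_snd).comp_measurePreserving (measurePreserving_splitEquiv S)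

theorem lintegral_splitMul (hΨ : AEMeas Ψ) (hΦ : AEMeas Φ) {k : ℕ} (S : Finset (Fin k)) :
    ∫⁻ y, ‖splitMul Ψ Φ S y‖ₑ =
      (∫⁻ y : Fin S.card → Space d, ‖atPoints Ψ y‖ₑ) *
        ∫⁻ y : Fin (k - S.card) → Space d, ‖atPoints Φ y‖ₑ := by
  simp only [splitMul, enorm_mul]
  rw [(measurePreserving_splitEquiv S).lintegral_comp_emb (MeasurableEquiv.measurableEmbedding _)
    fun z => ‖atPoints Ψ z.1‖ₑ * ‖atPoints Φ z.2‖ₑ]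
  exact lintegral_prod_mul (hΨ _).enorm (hΦ _).enorm

theorem integral_splitMul (Ψ Φ : Finset (Space d) → ℝ) {k : ℕ} (S : Finset (Fin k)) :
    ∫ y, splitMul Ψ Φ S y =
      (∫ y : Fin S.card → Space d, atPoints Ψ y) *
        ∫ y : Fin (k - S.card) → Space d, atPoints Φ y := by
  simp only [splitMul]
  rw [(measurePreserving_splitEquiv S).integral_comp (MeasurableEquiv.measurableEmbedding _)
    fun z => atPoints Ψ z.1 * atPoints Φ z.2]
  exact integral_prod_mul (fun z => atPoints Ψ z) fun z => atPoints Φ z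

theorem integrable_splitMul (hΨ : ∀ k, Integrable fun y : Fin k → Space d => atPoints Ψ y)
    (hΦ : ∀ k, Integrable fun y : Fin k → Space d => atPoints Φ y) {k : ℕ} (S : Finset (Fin k)) :
    Integrable (splitMul Ψ Φ S) :=
  (measurePreserving_splitEquiv S).integrable_comp_of_integrable ((hΨ _).mul_prod (hΦ _))

protected theorem AEMeas.starMul [Nontrivial (Space d)] (hΨ : AEMeas Ψ) (hΦ : AEMeas Φ) :
    AEMeas (starMul Ψ Φ) := fun k =>
  (Finset.aestronglyMeasurable_fun_sum _ fun S _ => aestronglyMeasurable_splitMul hΨ hΦ S).congr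
    (ae_atPoints_starMul Ψ Φ k).symm

theorem sum_finset_fin_card {R : Type*} [Semiring R] (k : ℕ) (g : ℕ → ℕ → R) :
    ∑ S : Finset (Fin k), g S.card (k - S.card) =
      ∑ p ∈ Finset.HasAntidiagonal.antidiagonal k, (k.choose p.1 : R) * g p.1 p.2 := by
  rw [← Finset.powerset_univ, Finset.sum_powerset_apply_card fun j => g j (k - j),
    Finset.card_univ, Fintype.card_fin,
    Finset.Nat.sum_antidiagonal_eq_sum_range_succ (fun i j => (k.choose i : R) * g i j)]
  simp only [nsmul_eq_mul]

theorem inv_factorial_mul_choose (i j : ℕ) :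
    ((i + j).factorial : ℝ)⁻¹ * (i + j).choose i = (i.factorial : ℝ)⁻¹ * (j.factorial : ℝ)⁻¹ := by
  have h : ((i + j).factorial : ℝ) ≠ 0 := by positivity
  rw [Nat.cast_add_choose]
  field_simp

theorem absTerm_starMul_le [Nontrivial (Space d)] (hΨ : AEMeas Ψ) (hΦ : AEMeas Φ) (k : ℕ) :
    absTerm (starMul Ψ Φ) k ≤
      ∑ p ∈ Finset.HasAntidiagonal.antidiagonal k, absTerm Ψ p.1 * absTerm Φ p.2 := by
  let a : ℕ → ℝ≥0∞ := fun i => ∫⁻ y : Fin i → Space d, ‖atPoints Ψ y‖ₑ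
  let b : ℕ → ℝ≥0∞ := fun i => ∫⁻ y : Fin i → Space d, ‖atPoints Φ y‖ₑ
  have hsum : ∫⁻ y : Fin k → Space d, ‖atPoints (starMul Ψ Φ) y‖ₑ ≤
      ∑ S : Finset (Fin k), a S.card * b (k - S.card) :=
    calc ∫⁻ y : Fin k → Space d, ‖atPoints (starMul Ψ Φ) y‖ₑ
        ≤ ∫⁻ y, ∑ S : Finset (Fin k), ‖splitMul Ψ Φ S y‖ₑ := by
          refine lintegral_mono_ae ?_
          filter_upwards [ae_atPoints_starMul Ψ Φ k] with y hy
          exact hy ▸ enorm_sum_le _ _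
      _ = ∑ S : Finset (Fin k), ∫⁻ y, ‖splitMul Ψ Φ S y‖ₑ :=
          lintegral_finsetSum' _ fun S _ => (aestronglyMeasurable_splitMul hΨ hΦ S).enorm
      _ = ∑ S : Finset (Fin k), a S.card * b (k - S.card) :=
          Finset.sum_congr rfl fun S _ => lintegral_splitMul hΨ hΦ S
  rw [absTerm]
  refine (mul_le_mul_right hsum _).trans_eq ?_
  rw [sum_finset_fin_card k (fun i j => a i * b j), Finset.mul_sum]
  refine Finset.sum_congr rfl fun p hp => ?_
  obtain rfl := Finset.HasAntidiagonal.mem_antidiagonal.1 hp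
  have : ENNReal.ofReal ((p.1 + p.2).factorial : ℝ)⁻¹ * ((p.1 + p.2).choose p.1 : ℝ≥0∞) =
      ENNReal.ofReal (p.1.factorial : ℝ)⁻¹ * ENNReal.ofReal (p.2.factorial : ℝ)⁻¹ := by
    rw [← ENNReal.ofReal_natCast, ← ENNReal.ofReal_mul (by positivity),
      ← ENNReal.ofReal_mul (by positivity), inv_factorial_mul_choose]
  rw [absTerm, absTerm, ← mul_assoc, this]
  ring

theorem expansionTerm_starMul [Nontrivial (Space d)]
    (hΨ : ∀ k, Integrable fun y : Fin k → Space d => atPoints Ψ y)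
    (hΦ : ∀ k, Integrable fun y : Fin k → Space d => atPoints Φ y) (k : ℕ) :
    expansionTerm (starMul Ψ Φ) k =
      ∑ p ∈ Finset.HasAntidiagonal.antidiagonal k, expansionTerm Ψ p.1 * expansionTerm Φ p.2 := by
  let a : ℕ → ℝ := fun i => ∫ y : Fin i → Space d, atPoints Ψ y
  let b : ℕ → ℝ := fun i => ∫ y : Fin i → Space d, atPoints Φ y
  have hsum : ∫ y : Fin k → Space d, atPoints (starMul Ψ Φ) y =
      ∑ S : Finset (Fin k), a S.card * b (k - S.card) := by
    rw [integral_congr_ae (ae_atPoints_starMul Ψ Φ k),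
      integral_finsetSum _ fun S _ => integrable_splitMul hΨ hΦ S]
    exact Finset.sum_congr rfl fun S _ => integral_splitMul Ψ Φ S
  rw [expansionTerm, hsum, sum_finset_fin_card k (fun i j => a i * b j), Finset.mul_sum]
  refine Finset.sum_congr rfl fun p hp => ?_
  obtain rfl := Finset.HasAntidiagonal.mem_antidiagonal.1 hp
  calc (-1) ^ (p.1 + p.2) / ((p.1 + p.2).factorial : ℝ) *
        ((p.1 + p.2).choose p.1 * (a p.1 * b p.2))
      = (-1) ^ p.1 * (-1) ^ p.2 *
        (((p.1 + p.2).factorial : ℝ)⁻¹ * (p.1 + p.2).choose p.1) * (a p.1 * b p.2) := by ring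
    _ = expansionTerm Ψ p.1 * expansionTerm Φ p.2 := by
      rw [inv_factorial_mul_choose, expansionTerm, expansionTerm]
      ring

end Integrals

/-! ### Absolutely convergent expansions -/

theorem sum_range_antidiagonal_mul_le (f g : ℕ → ℝ≥0∞) (K : ℕ) :
    ∑ k ∈ Finset.range K, ∑ p ∈ Finset.HasAntidiagonal.antidiagonal k, f p.1 * g p.2 ≤
      (∑ k ∈ Finset.range K, f k) * ∑' k, g k := by
  simp only [Finset.Nat.sum_antidiagonal_eq_sum_range_succ (fun i j => f i * g j)]
  simp only [Nat.succ_eq_add_one]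
  rw [Finset.sum_range_diag_flip _ fun i j => f i * g j, Finset.sum_mul]
  simp only [← Finset.mul_sum]
  gcongr
  exact ENNReal.sum_le_tsum _

section StarNorm

variable {F G : Finset (Space d) → ℝ} {t : ℝ≥0∞}

/-- The weighted `ℓ¹` norm `∑ (t^k / k!) ∫ |F^(k)|`. It is submultiplicative for `∗`, and its
finiteness at `t = 1` is the absolute convergence of the expansion of `F`. -/
def starNorm (t : ℝ≥0∞) (F : Finset (Space d) → ℝ) : ℝ≥0∞ := ∑' k, t ^ k * absTerm F k

theorem starNorm_one (F : Finset (Space d) → ℝ) : starNorm 1 F = ∑' k, absTerm F k := by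
  simp only [starNorm, one_pow, one_mul]

theorem starNorm_mono {s : ℝ≥0∞} (h : s ≤ t) (F : Finset (Space d) → ℝ) :
    starNorm s F ≤ starNorm t F := by
  unfold starNorm
  gcongr

theorem EqOff.starNorm_eq [Nontrivial (Space d)] {Z : Finset (Space d)} (h : EqOff Z F G)
    (t : ℝ≥0∞) : starNorm t F = starNorm t G := by
  simp only [starNorm, h.absTerm_eq]

theorem absTerm_add_le (hF : AEMeas F) (k : ℕ) : absTerm (F + G) k ≤ absTerm F k + absTerm G k := by
  rw [absTerm, absTerm, absTerm, ← mul_add, ← lintegral_add_left' (hF k).enorm]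
  gcongr
  exact enorm_add_le _ _

theorem starNorm_add_le (hF : AEMeas F) : starNorm t (F + G) ≤ starNorm t F + starNorm t G := by
  rw [starNorm, starNorm, starNorm, ← ENNReal.tsum_add]
  simp only [← mul_add]
  gcongr
  exact absTerm_add_le hF _

theorem absTerm_smul (c : ℝ) (F : Finset (Space d) → ℝ) (k : ℕ) :
    absTerm (c • F) k = ‖c‖ₑ * absTerm F k := by
  have : ∀ y : Fin k → Space d, ‖atPoints (c • F) y‖ₑ = ‖c‖ₑ * ‖atPoints F y‖ₑ :=
    fun y => enorm_mul _ _
  simp only [absTerm, this]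
  rw [lintegral_const_mul' _ _ enorm_ne_top]
  ring

theorem starNorm_smul (c : ℝ) (F : Finset (Space d) → ℝ) :
    starNorm t (c • F) = ‖c‖ₑ * starNorm t F := by
  simp only [starNorm, absTerm_smul, mul_left_comm _ ‖c‖ₑ, ENNReal.tsum_mul_left]

theorem absTerm_sub_le (hF : AEMeas F) (k : ℕ) : absTerm (F - G) k ≤ absTerm F k + absTerm G k := by
  have := absTerm_add_le (G := (-1 : ℝ) • G) hF k
  rwa [absTerm_smul, enorm_neg, enorm_one, one_mul, neg_one_smul, ← sub_eq_add_neg] at this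

theorem starNorm_sub_le (hF : AEMeas F) : starNorm t (F - G) ≤ starNorm t F + starNorm t G := by
  have := starNorm_add_le (t := t) (G := (-1 : ℝ) • G) hF
  rwa [starNorm_smul, enorm_neg, enorm_one, one_mul, neg_one_smul, ← sub_eq_add_neg] at this

theorem pow_mul_absTerm_starMul_le [Nontrivial (Space d)] (hF : AEMeas F) (hG : AEMeas G)
    (t : ℝ≥0∞) (k : ℕ) :
    t ^ k * absTerm (starMul F G) k ≤ ∑ p ∈ Finset.HasAntidiagonal.antidiagonal k,
      t ^ p.1 * absTerm F p.1 * (t ^ p.2 * absTerm G p.2) := by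
  refine (mul_le_mul_right (absTerm_starMul_le hF hG k) _).trans_eq ?_
  rw [Finset.mul_sum]
  refine Finset.sum_congr rfl fun p hp => ?_
  rw [← Finset.HasAntidiagonal.mem_antidiagonal.1 hp, pow_add]
  ring

theorem starNorm_starMul_le [Nontrivial (Space d)] (hF : AEMeas F) (hG : AEMeas G) :
    starNorm t (starMul F G) ≤ starNorm t F * starNorm t G := by
  refine ENNReal.tsum_le_of_sum_range_le fun K => ?_
  refine (Finset.sum_le_sum fun k _ => pow_mul_absTerm_starMul_le hF hG t k).trans ?_
  refine (sum_range_antidiagonal_mul_le (fun k => t ^ k * absTerm F k)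
    (fun k => t ^ k * absTerm G k) K).trans (mul_le_mul_left ?_ _)
  exact ENNReal.sum_le_tsum _

theorem atPoints_starOne_succ {k : ℕ} (y : Fin (k + 1) → Space d) : atPoints starOne y = 0 := by
  simp [atPoints, starOne, Finset.univ_nonempty.ne_empty]

theorem starNorm_starOne : starNorm t (starOne : Finset (Space d) → ℝ) = 1 := by
  rw [starNorm, tsum_eq_zero_add' ENNReal.summable, absTerm_zero]
  simp [absTerm, atPoints_starOne_succ, starOne]

protected theorem AEMeas.starPow [Nontrivial (Space d)] (hF : AEMeas F) (n : ℕ) :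
    AEMeas (starPow F n) := by
  induction n with
  | zero => exact aemeas_starOne
  | succ n ih => exact hF.starMul ih

theorem starNorm_starPow_le [Nontrivial (Space d)] (hF : AEMeas F) (n : ℕ) :
    starNorm t (starPow F n) ≤ starNorm t F ^ n := by
  induction n with
  | zero => rw [pow_zero, starPow_zero, starNorm_starOne]
  | succ n ih =>
    rw [pow_succ']
    exact (starNorm_starMul_le hF (hF.starPow n)).trans (mul_le_mul_right ih _)

variable {ι : Type*} [Countable ι] {Fs : ι → Finset (Space d) → ℝ}

protected theorem AEMeas.tsum (h : ∀ i, AEMeas (Fs i)) : AEMeas fun η => ∑' i, Fs i η :=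
  fun k => (AEMeasurable.tsum fun i => (h i k).aemeasurable).aestronglyMeasurable

theorem absTerm_tsum_le (h : ∀ i, AEMeas (Fs i)) (k : ℕ) :
    absTerm (fun η => ∑' i, Fs i η) k ≤ ∑' i, absTerm (Fs i) k := by
  simp only [absTerm]
  rw [ENNReal.tsum_mul_left, ← lintegral_tsum fun i => (h i k).enorm]
  gcongr
  exact enorm_tsum_le_tsum_enorm

theorem starNorm_tsum_le (h : ∀ i, AEMeas (Fs i)) :
    starNorm t (fun η => ∑' i, Fs i η) ≤ ∑' i, starNorm t (Fs i) := by
  simp only [starNorm]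
  rw [ENNReal.tsum_comm]
  simp only [ENNReal.tsum_mul_left]
  gcongr
  exact absTerm_tsum_le h _

end StarNorm

section Expansion

variable {F G : Finset (Space d) → ℝ}

/-- Absolute convergence of the expansion `∑ (-1)^k / k! ∫ F^(k)`. -/
structure AbsConv (F : Finset (Space d) → ℝ) : Prop where
  aemeas : AEMeas F
  starNorm_ne_top : starNorm 1 F ≠ ∞

/-- The sum `∑ (-1)^k / k! ∫ F^(k)`. On absolutely convergent expansions it is a character of the
algebra of functions on finite configurations with the product `∗`. -/
def expansion (F : Finset (Space d) → ℝ) : ℝ := ∑' k, expansionTerm F k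

theorem EqOff.expansion_eq [Nontrivial (Space d)] {Z : Finset (Space d)} (h : EqOff Z F G) :
    expansion F = expansion G := by
  simp only [expansion, h.expansionTerm_eq]

theorem AbsConv.congr_eqOff [Nontrivial (Space d)] {Z : Finset (Space d)} (hF : AbsConv F)
    (h : EqOff Z F G) : AbsConv G :=
  ⟨hF.aemeas.congr_eqOff h, h.starNorm_eq 1 ▸ hF.starNorm_ne_top⟩

theorem AbsConv.integrable (h : AbsConv F) (k : ℕ) :
    Integrable (fun y : Fin k → Space d => atPoints F y) :=
  integrable_atPoints h.aemeas
    (ENNReal.ne_top_of_tsum_ne_top (starNorm_one F ▸ h.starNorm_ne_top) k)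

theorem tsum_enorm_expansionTerm_le (F : Finset (Space d) → ℝ) :
    ∑' k, ‖expansionTerm F k‖ₑ ≤ starNorm 1 F := by
  rw [starNorm_one]
  gcongr
  exact enorm_expansionTerm_le F _

theorem AbsConv.summable_norm (h : AbsConv F) : Summable fun k => ‖expansionTerm F k‖ :=
  tsum_enorm_ne_top_iff_summable_norm.1
    (ne_top_of_le_ne_top h.starNorm_ne_top (tsum_enorm_expansionTerm_le F))

theorem AbsConv.expansion_eq_add (h : AbsConv F) :
    expansion F = F ∅ + ∑' k, expansionTerm F (k + 1) := by
  rw [expansion, h.summable_norm.of_norm.tsum_eq_zero_add, expansionTerm_zero]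

theorem AbsConv.expansion_eq_tsum (h : AbsConv F) (h0 : F ∅ = 0) :
    expansion F = ∑' k, expansionTerm F (k + 1) := by
  rw [h.expansion_eq_add, h0, zero_add]

theorem AbsConv.summable_expansionTerm_succ (h : AbsConv F) :
    Summable fun k => expansionTerm F (k + 1) :=
  (summable_nat_add_iff 1).2 h.summable_norm.of_norm

protected theorem AbsConv.add (hF : AbsConv F) (hG : AbsConv G) : AbsConv (F + G) :=
  ⟨hF.aemeas.add hG.aemeas, ne_top_of_le_ne_top
    (ENNReal.add_ne_top.2 ⟨hF.starNorm_ne_top, hG.starNorm_ne_top⟩) (starNorm_add_le hF.aemeas)⟩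

theorem AbsConv.expansion_add (hF : AbsConv F) (hG : AbsConv G) :
    expansion (F + G) = expansion F + expansion G := by
  rw [expansion, expansion, expansion,
    ← hF.summable_norm.of_norm.tsum_add hG.summable_norm.of_norm]
  refine tsum_congr fun k => ?_
  rw [expansionTerm, expansionTerm, expansionTerm, ← mul_add,
    ← integral_add (hF.integrable k) (hG.integrable k)]
  rfl

protected theorem AbsConv.smul (hF : AbsConv F) (c : ℝ) : AbsConv (c • F) :=
  ⟨hF.aemeas.const_smul c,
    starNorm_smul c F ▸ ENNReal.mul_ne_top enorm_ne_top hF.starNorm_ne_top⟩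

theorem expansionTerm_smul (c : ℝ) (F : Finset (Space d) → ℝ) (k : ℕ) :
    expansionTerm (c • F) k = c * expansionTerm F k := by
  have : ∀ y : Fin k → Space d, atPoints (c • F) y = c * atPoints F y := fun y => rfl
  simp only [expansionTerm, this, integral_const_mul, mul_left_comm c]

theorem expansion_smul (c : ℝ) (F : Finset (Space d) → ℝ) :
    expansion (c • F) = c * expansion F := by
  simp only [expansion, expansionTerm_smul, tsum_mul_left]

theorem absConv_starOne : AbsConv (starOne : Finset (Space d) → ℝ) :=
  ⟨aemeas_starOne, by simp only [starNorm_starOne, ne_eq, ENNReal.one_ne_top, not_false_iff]⟩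

theorem expansion_starOne : expansion (starOne : Finset (Space d) → ℝ) = 1 := by
  rw [absConv_starOne.expansion_eq_add]
  simp [expansionTerm, atPoints_starOne_succ, starOne]

theorem expansion_tsum {ι : Type*} [Countable ι] {Fs : ι → Finset (Space d) → ℝ}
    (hm : ∀ i, AEMeas (Fs i)) (h : ∑' i, starNorm 1 (Fs i) ≠ ∞) :
    expansion (fun η => ∑' i, Fs i η) = ∑' i, expansion (Fs i) := by
  have hterm : ∀ k, expansionTerm (fun η => ∑' i, Fs i η) k = ∑' i, expansionTerm (Fs i) k := by
    intro k
    have hk : ∑' i, ∫⁻ y : Fin k → Space d, ‖atPoints (Fs i) y‖ₑ ≠ ∞ := by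
      have hle : ∑' i, absTerm (Fs i) k ≤ ∑' i, starNorm 1 (Fs i) := by
        simp only [starNorm_one]
        gcongr
        exact ENNReal.le_tsum k
      simp only [absTerm, ENNReal.tsum_mul_left] at hle
      refine fun htop => h (top_unique (le_trans ?_ hle))
      rw [htop, ENNReal.mul_top (ENNReal.ofReal_pos.2 (by positivity)).ne']
    simp only [expansionTerm, tsum_mul_left]
    exact congrArg _ (integral_tsum (fun i => hm i k) hk)
  have hsum : Summable (Function.uncurry fun k i => expansionTerm (Fs i) k) := by
    refine Summable.of_norm (tsum_enorm_ne_top_iff_summable_norm.1 ?_)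
    rw [ENNReal.tsum_prod', ENNReal.tsum_comm]
    refine ne_top_of_le_ne_top h ?_
    gcongr
    exact tsum_enorm_expansionTerm_le _
  simp only [expansion, hterm]
  exact (Summable.tsum_comm hsum).symm

variable [Nontrivial (Space d)]

protected theorem AbsConv.starMul (hF : AbsConv F) (hG : AbsConv G) : AbsConv (starMul F G) :=
  ⟨hF.aemeas.starMul hG.aemeas, ne_top_of_le_ne_top
    (ENNReal.mul_ne_top hF.starNorm_ne_top hG.starNorm_ne_top)
    (starNorm_starMul_le hF.aemeas hG.aemeas)⟩

theorem AbsConv.expansion_starMul (hF : AbsConv F) (hG : AbsConv G) :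
    expansion (starMul F G) = expansion F * expansion G := by
  rw [expansion, expansion, expansion,
    tsum_mul_tsum_eq_tsum_sum_antidiagonal_of_summable_norm hF.summable_norm hG.summable_norm]
  exact tsum_congr fun k => expansionTerm_starMul hF.integrable hG.integrable k

protected theorem AbsConv.starPow (hF : AbsConv F) (n : ℕ) : AbsConv (starPow F n) :=
  ⟨hF.aemeas.starPow n, ne_top_of_le_ne_top (ENNReal.pow_ne_top hF.starNorm_ne_top)
    (starNorm_starPow_le hF.aemeas n)⟩

theorem AbsConv.expansion_starPow (hF : AbsConv F) (n : ℕ) :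
    expansion (starPow F n) = expansion F ^ n := by
  induction n with
  | zero => rw [pow_zero, starPow_zero, expansion_starOne]
  | succ n ih =>
    rw [pow_succ', ← ih]
    exact hF.expansion_starMul (hF.starPow n)

theorem tsum_starNorm_starPow_ne_top (hF : AbsConv F) :
    ∑' n : ℕ, starNorm 1 ((n.factorial : ℝ)⁻¹ • starPow F n) ≠ ∞ := by
  refine ne_top_of_le_ne_top
    (Real.summable_pow_div_factorial (starNorm 1 F).toReal).tsum_ofReal_ne_top
    (ENNReal.tsum_le_tsum fun n => ?_)
  rw [starNorm_smul, div_eq_inv_mul, ENNReal.ofReal_mul (by positivity),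
    ENNReal.ofReal_pow ENNReal.toReal_nonneg, ENNReal.ofReal_toReal hF.starNorm_ne_top,
    Real.enorm_eq_ofReal (by positivity)]
  gcongr
  exact starNorm_starPow_le hF.aemeas n

protected theorem AbsConv.starExp (hF : AbsConv F) : AbsConv (starExp F) :=
  have hm (n : ℕ) := (hF.aemeas.starPow n).const_smul (n.factorial : ℝ)⁻¹
  ⟨AEMeas.tsum hm, ne_top_of_le_ne_top (tsum_starNorm_starPow_ne_top hF) (starNorm_tsum_le hm)⟩

theorem AbsConv.expansion_starExp (hF : AbsConv F) :
    expansion (starExp F) = Real.exp (expansion F) := by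
  rw [Real.exp_eq_exp_ℝ, NormedSpace.exp_eq_tsum_div]
  refine (expansion_tsum (fun n => (hF.aemeas.starPow n).const_smul _)
    (tsum_starNorm_starPow_ne_top hF)).trans (tsum_congr fun n => ?_)
  rw [expansion_smul, hF.expansion_starPow, div_eq_inv_mul]

end Expansion

/-! ### Division and logarithms near the unit -/

section Division

variable {Q Ψ F G : Finset (Space d) → ℝ} {Z : Finset (Space d)} {t : ℝ≥0∞}

theorem tsum_le_two_mul_of_convolution {q g f : ℕ → ℝ≥0∞} (hf0 : f 0 = 0)
    (h : ∀ k, q k ≤ g k + ∑ p ∈ Finset.HasAntidiagonal.antidiagonal k, q p.1 * f p.2)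
    (hf : ∑' k, f k ≤ 2⁻¹) : ∑' k, q k ≤ 2 * ∑' k, g k := by
  have hsucc (k : ℕ) : ∑ p ∈ Finset.HasAntidiagonal.antidiagonal (k + 1), q p.1 * f p.2 =
      ∑ p ∈ Finset.HasAntidiagonal.antidiagonal k, q p.1 * f (p.2 + 1) := by
    rw [Finset.Nat.sum_antidiagonal_succ', hf0, mul_zero, zero_add]
  have hf' : ∑' k, f (k + 1) ≤ 2⁻¹ :=
    (ENNReal.tsum_comp_le_tsum_of_injective (add_left_injective 1) f).trans hf
  refine ENNReal.tsum_le_of_sum_range_le fun K => ?_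
  induction K with
  | zero => simp
  | succ K ih =>
    calc ∑ k ∈ Finset.range (K + 1), q k
        ≤ ∑ k ∈ Finset.range (K + 1), (g k +
            ∑ p ∈ Finset.HasAntidiagonal.antidiagonal k, q p.1 * f p.2) := by
          gcongr with k
          exact h k
      _ = ∑ k ∈ Finset.range (K + 1), g k + ∑ k ∈ Finset.range K,
            ∑ p ∈ Finset.HasAntidiagonal.antidiagonal k, q p.1 * f (p.2 + 1) := by
          rw [Finset.sum_add_distrib]
          congr 1
          rw [Finset.sum_range_succ']
          simp [hsucc, hf0]
      _ ≤ ∑' k, g k + (∑ k ∈ Finset.range K, q k) * ∑' k, f (k + 1) := by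
          gcongr
          · exact ENNReal.sum_le_tsum _
          · exact sum_range_antidiagonal_mul_le q (fun k => f (k + 1)) K
      _ ≤ ∑' k, g k + 2 * (∑' k, g k) * 2⁻¹ := by gcongr
      _ = 2 * ∑' k, g k := by
          rw [mul_right_comm, ENNReal.mul_inv_cancel two_ne_zero ENNReal.ofNat_ne_top, one_mul,
            two_mul]

/-- The part of `F` that vanishes at the empty configuration, so that `F = F(∅) 𝟙 + tail F`. -/
def tail (F : Finset (Space d) → ℝ) : Finset (Space d) → ℝ := F - F ∅ • starOne

theorem smul_starOne_add_tail (F : Finset (Space d) → ℝ) : F ∅ • starOne + tail F = F :=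
  add_sub_cancel _ _

theorem tail_empty (F : Finset (Space d) → ℝ) : tail F ∅ = 0 := by
  simp [tail, starOne]

theorem AEMeas.sub (hF : AEMeas F) (hG : AEMeas G) : AEMeas (F - G) :=
  fun k => (hF k).sub (hG k)

protected theorem AEMeas.tail (hF : AEMeas F) : AEMeas (tail F) :=
  hF.sub (aemeas_starOne.const_smul _)

theorem starNorm_tail (t : ℝ≥0∞) (F : Finset (Space d) → ℝ) :
    starNorm t (tail F) = ∑' k, t ^ (k + 1) * absTerm F (k + 1) := by
  have hsucc (k : ℕ) (y : Fin (k + 1) → Space d) : atPoints (tail F) y = atPoints F y := by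
    have := atPoints_starOne_succ y
    simp only [atPoints] at this
    simp [atPoints, tail, this]
  rw [starNorm, tsum_eq_zero_add' ENNReal.summable, absTerm_zero, tail_empty]
  simp [absTerm, hsucc]

theorem starNorm_ne_top_iff_tail : starNorm t F ≠ ∞ ↔ starNorm t (tail F) ≠ ∞ := by
  rw [starNorm_tail, starNorm, tsum_eq_zero_add' ENNReal.summable, absTerm_zero]
  simp [ENNReal.add_eq_top]

theorem tail_starMul (hF : F ∅ = 1) (hG : G ∅ = 1) :
    tail (starMul F G) = tail F + tail G + starMul (tail F) (tail G) := by
  have h1 : starMul F G ∅ = 1 := by rw [starMul_empty, hF, hG, one_mul]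
  have hF' : F = starOne + tail F := by rw [← one_smul ℝ starOne, ← hF, smul_starOne_add_tail]
  have hG' : G = starOne + tail G := by rw [← one_smul ℝ starOne, ← hG, smul_starOne_add_tail]
  rw [tail, h1, one_smul, sub_eq_iff_eq_add]
  conv_lhs => rw [hF', hG', starMul_add_left, starOne_starMul, starMul_add_right, starMul_starOne]
  abel

theorem card_image_univ_le {k : ℕ} (y : Fin k → Space d) : (Finset.univ.image y).card ≤ k :=
  Finset.card_image_le.trans (by simp)

variable [Nontrivial (Space d)]

theorem AEMeas.of_starMul (hΨ : AEMeas Ψ) (h1 : Ψ ∅ = 1) (hG : AEMeas G)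
    (h : EqOff Z (starMul Q Ψ) G) : AEMeas Q := by
  intro k
  induction k using Nat.strong_induction_on with
  | _ k ih =>
    let Q' : Finset (Space d) → ℝ := fun η => if η.card < k then Q η else 0
    have hQ' : AEMeas Q' := by
      intro j
      rcases lt_or_ge j k with hj | hj
      · refine (ih j hj).congr (Eventually.of_forall fun y => ?_)
        exact (if_pos ((card_image_univ_le y).trans_lt hj)).symm
      · refine (aestronglyMeasurable_const (b := 0)).congr ?_
        filter_upwards [ae_injective j] with y hy
        exact (if_neg (by rw [card_image_univ hy]; exact hj.not_gt)).symm
    refine ((hG k).sub (hQ'.starMul hΨ k)).congr ?_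
    filter_upwards [ae_injective k, ae_disjoint_finset Z k] with y hy hyZ
    have hproper : ∀ γ ⊂ Finset.univ.image y, Q γ = Q' γ := fun γ hγ =>
      (if_pos ((Finset.card_lt_card hγ).trans_le (card_image_univ_le y))).symm
    have htop : Q' (Finset.univ.image y) = 0 :=
      if_neg (by rw [card_image_univ hy]; exact lt_irrefl k)
    have := starMul_sub_of_eq_ssubset hproper Ψ
    rwa [h _ hyZ, h1, htop, sub_zero, mul_one] at this

theorem starNorm_le_of_starMul (hΨ : AEMeas Ψ) (h1 : Ψ ∅ = 1) (hG : AEMeas G)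
    (h : EqOff Z (starMul Q Ψ) G) (ht : starNorm t (tail Ψ) ≤ 2⁻¹) :
    starNorm t Q ≤ 2 * starNorm t G := by
  have hQ : AEMeas Q := hΨ.of_starMul h1 hG h
  have hsub : EqOff Z Q (G - starMul Q (tail Ψ)) := fun η hη => by
    have : starMul Q Ψ = Q + starMul Q (tail Ψ) := by
      conv_lhs => rw [← smul_starOne_add_tail Ψ, h1, one_smul, starMul_add_right, starMul_starOne]
    rw [Pi.sub_apply, ← h η hη, this, Pi.add_apply, add_sub_cancel_right]
  refine tsum_le_two_mul_of_convolution (f := fun k => t ^ k * absTerm (tail Ψ) k)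
    (by simp [absTerm_zero, tail_empty]) (fun k => ?_) ht
  calc t ^ k * absTerm Q k
      ≤ t ^ k * (absTerm G k + absTerm (starMul Q (tail Ψ)) k) := by
        rw [hsub.absTerm_eq]
        gcongr
        exact absTerm_sub_le hG k
    _ ≤ _ := by
        rw [mul_add]
        gcongr
        exact pow_mul_absTerm_starMul_le hQ hΨ.tail t k

theorem ae_atPoints_numberOp (F : Finset (Space d) → ℝ) (k : ℕ) :
    (fun y : Fin k → Space d => atPoints (numberOp F) y) =ᵐ[volume]
      fun y => (k : ℝ) * atPoints F y := by
  filter_upwards [ae_injective k] with y hy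
  rw [atPoints, numberOp, card_image_univ hy, atPoints]

theorem AEMeas.numberOp (hF : AEMeas F) : AEMeas (numberOp F) := fun k =>
  ((hF k).const_mul _).congr (ae_atPoints_numberOp F k).symm

theorem AEMeas.of_numberOp (hF : AEMeas (InverseGibbs.numberOp F)) : AEMeas F := by
  rintro (_ | k)
  · exact StronglyMeasurable.of_discrete.aestronglyMeasurable
  · refine ((hF (k + 1)).const_mul ((k + 1 : ℕ) : ℝ)⁻¹).congr ?_
    filter_upwards [ae_atPoints_numberOp F (k + 1)] with y hy
    rw [hy, inv_mul_cancel_left₀ (by positivity)]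

theorem absTerm_numberOp (F : Finset (Space d) → ℝ) (k : ℕ) :
    absTerm (numberOp F) k = k * absTerm F k := by
  have : (fun y : Fin k → Space d => ‖atPoints (numberOp F) y‖ₑ) =ᵐ[volume]
      fun y => k * ‖atPoints F y‖ₑ := by
    filter_upwards [ae_atPoints_numberOp F k] with y hy
    rw [hy, enorm_mul, Real.enorm_natCast]
  rw [absTerm, absTerm, lintegral_congr_ae this,
    lintegral_const_mul' _ _ (ENNReal.natCast_ne_top k), mul_left_comm]

theorem starNorm_numberOp_le (F : Finset (Space d) → ℝ) :
    starNorm 1 (numberOp F) ≤ starNorm 2 (tail F) := by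
  rw [starNorm, starNorm_tail, tsum_eq_zero_add' ENNReal.summable]
  simp only [absTerm_numberOp, one_pow, one_mul, Nat.cast_zero, zero_mul, zero_add]
  gcongr with k
  exact_mod_cast (Nat.lt_two_pow_self (n := k + 1)).le

theorem starNorm_tail_le_numberOp (F : Finset (Space d) → ℝ) :
    starNorm 1 (tail F) ≤ starNorm 1 (numberOp F) := by
  rw [starNorm_tail, starNorm,
    tsum_eq_zero_add' (f := fun k => 1 ^ k * absTerm (numberOp F) k) ENNReal.summable]
  refine le_add_left (ENNReal.tsum_le_tsum fun k => ?_)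
  rw [absTerm_numberOp]
  gcongr
  exact le_mul_of_one_le_left' (by exact_mod_cast Nat.succ_le_succ (Nat.zero_le k))

theorem AbsConv.of_starExp {ω : Finset (Space d) → ℝ} (h0 : ω ∅ = 0)
    (hm : AEMeas (starExp ω)) (ht : starNorm 2 (tail (starExp ω)) ≤ 2⁻¹) : AbsConv ω := by
  have h1 := starExp_empty h0
  have hmul : EqOff ∅ (starMul (numberOp ω) (starExp ω)) (numberOp (starExp ω)) :=
    .of_eq (numberOp_starExp h0).symm
  have hω : AEMeas ω := .of_numberOp (hm.of_starMul h1 hm.numberOp hmul)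
  refine ⟨hω, starNorm_ne_top_iff_tail.2 ?_⟩
  have hle : starNorm 1 (tail ω) ≤ 2 * 2⁻¹ :=
    calc starNorm 1 (tail ω)
        ≤ starNorm 1 (numberOp ω) := starNorm_tail_le_numberOp ω
      _ ≤ 2 * starNorm 1 (numberOp (starExp ω)) :=
          starNorm_le_of_starMul hm h1 hm.numberOp hmul
            ((starNorm_mono one_le_two _).trans ht)
      _ ≤ 2 * 2⁻¹ := by
          gcongr
          exact (starNorm_numberOp_le _).trans ht
  exact ne_top_of_le_ne_top (by simp) hle

end Division

/-! ### Absolute convergence of the functions `ω` -/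

section Bounds

variable {Q N G : Finset (Space d) → ℝ} {t : ℝ≥0∞}

theorem tail_sub_smul_starOne (F : Finset (Space d) → ℝ) (c : ℝ) :
    tail (F - c • starOne) = tail F := by
  have : (F - c • starOne : Finset (Space d) → ℝ) ∅ = F ∅ - c := by simp [starOne]
  rw [tail, this, tail, sub_smul]
  abel

theorem starNorm_tail_starMul_le [Nontrivial (Space d)] (hQ : AEMeas Q) (hN : AEMeas N)
    (hQ1 : Q ∅ = 1) (hN1 : N ∅ = 1) :
    starNorm t (tail (starMul Q N)) ≤ starNorm t (tail Q) + starNorm t (tail N) +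
      starNorm t (tail Q) * starNorm t (tail N) := by
  rw [tail_starMul hQ1 hN1]
  exact (starNorm_add_le (hQ.tail.add hN.tail)).trans
    (add_le_add (starNorm_add_le hQ.tail) (starNorm_starMul_le hQ.tail hN.tail))

theorem starNorm_tail_le_of_starMul [Nontrivial (Space d)] (hN : AEMeas N) (hN1 : N ∅ = 1)
    (hG : AEMeas G) (h : starMul Q N = G) (ht : starNorm t (tail N) ≤ 2⁻¹) :
    starNorm t (tail Q) ≤ 2 * (starNorm t (tail G) + ‖Q ∅‖ₑ * starNorm t (tail N)) := by
  have hG0 : G ∅ = Q ∅ := by rw [← h, starMul_empty, hN1, mul_one]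
  have htail : starMul (tail Q) N = tail G - Q ∅ • tail N := by
    rw [tail, starMul_sub_left, h, starMul_smul_left, starOne_starMul, tail, tail, hG0, hN1,
      one_smul, smul_sub]
    abel
  refine (starNorm_le_of_starMul (Z := ∅) hN hN1 (hG.tail.sub (hN.tail.const_smul _))
    (.of_eq htail) ht).trans ?_
  rw [← starNorm_smul]
  gcongr
  exact starNorm_sub_le hG.tail

theorem starNorm_two_tail_le_of_geometric {F : Finset (Space d) → ℝ} {C q : ℝ} (hC : 0 ≤ C)
    (hq : 0 ≤ q) (hq4 : 4 * q ≤ 1)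
    (h : ∀ k, absTerm F (k + 1) ≤ ENNReal.ofReal (C * q ^ (k + 1))) :
    starNorm 2 (tail F) ≤ ENNReal.ofReal (4 * C * q) := by
  have hs : HasSum (fun k : ℕ => C * (2 * q) * (2 * q) ^ k) (C * (2 * q) * (1 - 2 * q)⁻¹) :=
    (hasSum_geometric_of_lt_one (by positivity) (by linarith)).mul_left _
  rw [starNorm_tail]
  calc ∑' k, 2 ^ (k + 1) * absTerm F (k + 1)
      ≤ ∑' k : ℕ, ENNReal.ofReal (C * (2 * q) * (2 * q) ^ k) := by
        refine ENNReal.tsum_le_tsum fun k => (mul_le_mul_right (h k) _).trans_eq ?_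
        rw [← ENNReal.ofReal_ofNat, ← ENNReal.ofReal_pow zero_le_two,
          ← ENNReal.ofReal_mul (by positivity)]
        ring_nf
    _ = ENNReal.ofReal (C * (2 * q) * (1 - 2 * q)⁻¹) := by
        rw [← ENNReal.ofReal_tsum_of_nonneg (fun k => by positivity) hs.summable, hs.tsum_eq]
    _ ≤ ENNReal.ofReal (C * (2 * q) * 2) := by
        have : (1 - 2 * q)⁻¹ ≤ 2 := inv_le_of_inv_le₀ two_pos (by linarith)
        gcongr
    _ = ENNReal.ofReal (4 * C * q) := by ring_nf

variable {ρ : Finset (Space d) → ℝ} {x x₁ x₂ : Space d}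

theorem aemeas_of_dOp (hm : ∀ γ, AEMeas (dOp γ ρ)) : AEMeas ρ := dOp_empty ρ ▸ hm ∅

theorem aemeas_dOp_truncated_singleton [Nontrivial (Space d)] (h : ρ ∅ = 1)
    (hm : ∀ γ, AEMeas (dOp γ ρ)) (x : Space d) : AEMeas (dOp {x} (truncated ρ)) := by
  refine (aemeas_of_dOp hm).of_starMul h (hm {x}) (Z := {x}) fun η hη => ?_
  rw [dOp_singleton_eq_starMul h x η hη, starMul_comm]

theorem aemeas_normD [Nontrivial (Space d)] (h : ρ ∅ = 1) (hm : ∀ γ, AEMeas (dOp γ ρ))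
    (x : Space d) : AEMeas (normD ρ x) := by
  rw [normD_eq_smul]
  exact (aemeas_dOp_truncated_singleton h hm x).const_smul _

theorem aemeas_normD₂ [Nontrivial (Space d)] (h : ρ ∅ = 1) (hm : ∀ γ, AEMeas (dOp γ ρ))
    (h12 : x₁ ≠ x₂) : AEMeas (normD₂ ρ x₁ x₂) := by
  have hρ := aemeas_of_dOp hm
  have hD := (aemeas_dOp_truncated_singleton h hm x₁).starMul
    (aemeas_dOp_truncated_singleton h hm x₂)
  refine (hρ.of_starMul h ((hm {x₁, x₂}).sub (hρ.starMul hD)) (Z := {x₁, x₂})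
    fun η hη => ?_).const_smul _
  rw [Pi.sub_apply, dOp_pair_eq_starMul h h12 η hη, starMul_add_right, Pi.add_apply,
    add_sub_cancel_left, starMul_comm]

variable {M A D b : ℝ}

theorem AssumptionB.absTerm_le (hB : AssumptionB ρ M A D) (k : ℕ) {γ : Finset (Space d)}
    (hγ : γ.card = 1 ∨ γ.card = 2) :
    absTerm (dOp γ (truncated ρ)) (k + 1) ≤ ENNReal.ofReal (((k + 1).factorial : ℝ)⁻¹ *
      (((γ.card + (k + 1) - 1).factorial : ℝ) * M * A ^ γ.card * D ^ (k + 1) *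
        ∏ p ∈ γ, ρ {p})) := by
  have := hB Set.univ MeasurableSet.univ (k + 1) k.succ_pos γ hγ
  rw [Set.pi_univ, Measure.restrict_univ] at this
  rw [ENNReal.ofReal_mul (by positivity), absTerm]
  gcongr

theorem AssumptionB.starNorm_tail_normD_le (hB : AssumptionB ρ M A D) (hM : 0 < M) (hA : 0 < A)
    (hD : 0 < D) (hD4 : 4 * D ≤ 1) (hx : 0 < ρ {x}) :
    starNorm 2 (tail (normD ρ x)) ≤ ENNReal.ofReal (4 * (M * A) * D) := by
  refine starNorm_two_tail_le_of_geometric (by positivity) hD.le hD4 fun k => ?_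
  rw [normD_eq_smul, absTerm_smul, Real.enorm_eq_ofReal (by positivity)]
  refine (mul_le_mul_right (hB.absTerm_le k (.inl (Finset.card_singleton x))) _).trans_eq ?_
  rw [← ENNReal.ofReal_mul (by positivity), Finset.card_singleton, Nat.add_sub_cancel_left,
    Finset.prod_singleton]
  field_simp

theorem AssumptionB.starNorm_tail_normD₂_le (hB : AssumptionB ρ M A D) (hM : 0 < M) (hA : 0 < A)
    (hD : 0 < D) (hD8 : 8 * D ≤ 1) (h12 : x₁ ≠ x₂) (hx : 0 < ρ {x₁, x₂})
    (hc0 : 0 ≤ invPairCorr ρ x₁ x₂) (hcb : invPairCorr ρ x₁ x₂ ≤ b) :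
    starNorm 2 (tail (normD₂ ρ x₁ x₂)) ≤ ENNReal.ofReal (8 * (M * A ^ 2 * b) * D) := by
  have hb0 : 0 ≤ b := hc0.trans hcb
  suffices ∀ k, absTerm (normD₂ ρ x₁ x₂) (k + 1) ≤
      ENNReal.ofReal (M * A ^ 2 * b * (2 * D) ^ (k + 1)) by
    refine (starNorm_two_tail_le_of_geometric (by positivity) (by positivity) (by linarith)
      this).trans_eq ?_
    ring_nf
  intro k
  have hc : ({x₁, x₂} : Finset (Space d)).card = 2 := Finset.card_pair h12
  have h2 : ((k + 2 : ℕ) : ℝ) ≤ 2 ^ (k + 1) := by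
    exact_mod_cast (Nat.lt_two_pow_self (n := k + 1))
  rw [normD₂, absTerm_smul, Real.enorm_eq_ofReal (by positivity)]
  refine (mul_le_mul_right (hB.absTerm_le k (.inr hc)) _).trans ?_
  rw [← ENNReal.ofReal_mul (by positivity), hc, Finset.prod_pair h12,
    show 2 + (k + 1) - 1 = (k + 1) + 1 by omega, Nat.factorial_succ (k + 1)]
  refine ENNReal.ofReal_le_ofReal ?_
  calc (ρ {x₁, x₂})⁻¹ * (((k + 1).factorial : ℝ)⁻¹ *
        (((k + 2) * (k + 1).factorial : ℕ) * M * A ^ 2 * D ^ (k + 1) * (ρ {x₁} * ρ {x₂})))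
      = ((k + 2 : ℕ) : ℝ) * (M * A ^ 2 * D ^ (k + 1)) * invPairCorr ρ x₁ x₂ := by
        rw [invPairCorr]
        push_cast
        field_simp
    _ ≤ 2 ^ (k + 1) * (M * A ^ 2 * D ^ (k + 1)) * b :=
        mul_le_mul (mul_le_mul_of_nonneg_right h2 (by positivity)) hcb hc0 (by positivity)
    _ = M * A ^ 2 * b * (2 * D) ^ (k + 1) := by rw [mul_pow]; ring

/-- The constant `D₀` of the theorem, with `b` a bound on `ρ^(1)(x₁) ρ^(1)(x₂) / ρ^(2)(x₁,x₂)`: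
below it, `exp^∗ ω_x` and `exp^∗ ω_{x₁,x₂}` lie within `1/2` of `𝟙` in the norm of weight `2`. -/
def clusterRadius (M A b : ℝ) : ℝ :=
  (8 + 32 * (M * A ^ 2 * b) + 48 * (M * A * (1 + b)))⁻¹

theorem clusterRadius_pos (hM : 0 < M) (hA : 0 < A) (hb : 0 ≤ b) : 0 < clusterRadius M A b := by
  rw [clusterRadius]
  positivity

theorem smallness_of_le_clusterRadius (hM : 0 < M) (hA : 0 < A) (hD : 0 < D) (hb : 0 ≤ b)
    (hDb : D ≤ clusterRadius M A b) : 8 * D ≤ 1 ∧ 24 * (M * A) * D ≤ 1 ∧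
      32 * (M * A ^ 2 * b) * D + 48 * (M * A * (1 + b)) * D ≤ 1 := by
  have hsum : (8 + 32 * (M * A ^ 2 * b) + 48 * (M * A * (1 + b))) * D ≤ 1 :=
    (mul_comm _ _).trans_le ((le_mul_inv_iff₀ (by positivity)).1 (by rwa [one_mul]))
  have hMAb : 0 ≤ M * A ^ 2 * b * D := by positivity
  have hMA : 0 ≤ M * A * D := by positivity
  have hMAb' : 0 ≤ M * A * b * D := by positivity
  exact ⟨by linarith, by linarith, by linarith⟩

theorem absConv_omega1 [Nontrivial (Space d)] (h : ρ ∅ = 1) (hm : ∀ γ, AEMeas (dOp γ ρ))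
    (hB : AssumptionB ρ M A D) (hM : 0 < M) (hA : 0 < A) (hD : 0 < D) (hb : 0 ≤ b)
    (hDb : D ≤ clusterRadius M A b) (hx : 0 < ρ {x}) : AbsConv (omega1 ρ x) := by
  obtain ⟨hD8, hMA, -⟩ := smallness_of_le_clusterRadius hM hA hD hb hDb
  refine AbsConv.of_starExp (omega1_empty h hx.ne') ?_ ?_ <;> rw [starExp_omega1 h hx.ne']
  · exact aemeas_normD h hm x
  · refine (hB.starNorm_tail_normD_le hM hA hD (by linarith) hx).trans ?_
    exact ENNReal.ofReal_le_of_le_toReal (by rw [ENNReal.toReal_inv]; norm_num; linarith)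

theorem AssumptionB.starNorm_tail_normD_starMul_normD_le [Nontrivial (Space d)]
    (hB : AssumptionB ρ M A D) (h : ρ ∅ = 1)
    (hm : ∀ γ, AEMeas (dOp γ ρ)) (hM : 0 < M) (hA : 0 < A) (hD : 0 < D)
    (hD4 : 4 * D ≤ 1) (hMA : 4 * (M * A) * D ≤ 1) (hx₁ : 0 < ρ {x₁}) (hx₂ : 0 < ρ {x₂}) :
    starNorm 2 (tail (starMul (normD ρ x₁) (normD ρ x₂))) ≤
      ENNReal.ofReal (12 * (M * A) * D) := by
  have hN₁ := hB.starNorm_tail_normD_le hM hA hD hD4 hx₁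
  have hN₂ := hB.starNorm_tail_normD_le hM hA hD hD4 hx₂
  set f := 4 * (M * A) * D
  have hf : 0 ≤ f := by positivity
  calc _ ≤ _ := starNorm_tail_starMul_le (aemeas_normD h hm x₁) (aemeas_normD h hm x₂)
        (normD_empty h hx₁.ne') (normD_empty h hx₂.ne')
    _ ≤ ENNReal.ofReal f + ENNReal.ofReal f + ENNReal.ofReal f * ENNReal.ofReal f := by gcongr
    _ = ENNReal.ofReal (f + f + f * f) := by
        rw [← ENNReal.ofReal_mul hf, ← ENNReal.ofReal_add hf hf,
          ← ENNReal.ofReal_add (by positivity) (by positivity)]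
    _ ≤ ENNReal.ofReal (3 * f) := ENNReal.ofReal_le_ofReal (by nlinarith)
    _ = ENNReal.ofReal (12 * (M * A) * D) := by simp only [f]; ring_nf

theorem aemeas_starExp_omega2 [Nontrivial (Space d)] (h : ρ ∅ = 1)
    (hm : ∀ γ, AEMeas (dOp γ ρ)) (h12 : x₁ ≠ x₂) (hx₁ : ρ {x₁} ≠ 0) (hx₂ : ρ {x₂} ≠ 0)
    (hx : ρ {x₁, x₂} ≠ 0) : AEMeas (starExp (omega2 ρ x₁ x₂)) := by
  have hQN : EqOff ∅ (starMul (starMul (starExp (omega2 ρ x₁ x₂) - invPairCorr ρ x₁ x₂ • starOne)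
      (normD ρ x₁)) (normD ρ x₂)) (normD₂ ρ x₁ x₂) :=
    .of_eq (normD₂_eq_starMul h h12 hx₁ hx₂ hx).symm
  have hQN₁ := (aemeas_normD h hm x₂).of_starMul (normD_empty h hx₂) (aemeas_normD₂ h hm h12) hQN
  have hQ := (aemeas_normD h hm x₁).of_starMul (normD_empty h hx₁) hQN₁ (.of_eq (Z := ∅) rfl)
  simpa only [sub_add_cancel] using hQ.add (aemeas_starOne.const_smul (invPairCorr ρ x₁ x₂))

theorem starNorm_tail_starExp_omega2_le [Nontrivial (Space d)] (h : ρ ∅ = 1)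
    (hm : ∀ γ, AEMeas (dOp γ ρ)) (h12 : x₁ ≠ x₂) (hx₁ : ρ {x₁} ≠ 0) (hx₂ : ρ {x₂} ≠ 0)
    (hx : ρ {x₁, x₂} ≠ 0)
    (ht : starNorm t (tail (starMul (normD ρ x₁) (normD ρ x₂))) ≤ 2⁻¹) :
    starNorm t (tail (starExp (omega2 ρ x₁ x₂))) ≤ 2 * (starNorm t (tail (normD₂ ρ x₁ x₂)) +
      ‖1 - invPairCorr ρ x₁ x₂‖ₑ * starNorm t (tail (starMul (normD ρ x₁) (normD ρ x₂)))) := by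
  have hQ0 : (starExp (omega2 ρ x₁ x₂) - invPairCorr ρ x₁ x₂ • starOne :
      Finset (Space d) → ℝ) ∅ = 1 - invPairCorr ρ x₁ x₂ := by
    simp [starExp_empty (omega2_empty h h12 hx₁ hx₂ hx), starOne]
  rw [← tail_sub_smul_starOne _ (invPairCorr ρ x₁ x₂), ← hQ0]
  refine starNorm_tail_le_of_starMul ((aemeas_normD h hm x₁).starMul (aemeas_normD h hm x₂)) ?_
    (aemeas_normD₂ h hm h12) ?_ ht
  · rw [starMul_empty, normD_empty h hx₁, normD_empty h hx₂, mul_one]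
  · rw [normD₂_eq_starMul h h12 hx₁ hx₂ hx, starMul_assoc]

theorem absConv_omega2 [Nontrivial (Space d)] (h : ρ ∅ = 1) (hm : ∀ γ, AEMeas (dOp γ ρ))
    (hB : AssumptionB ρ M A D) (hM : 0 < M) (hA : 0 < A) (hD : 0 < D)
    (hDb : D ≤ clusterRadius M A b) (h12 : x₁ ≠ x₂) (hx₁ : 0 < ρ {x₁}) (hx₂ : 0 < ρ {x₂})
    (hx : 0 < ρ {x₁, x₂}) (hb : invPairCorr ρ x₁ x₂ ≤ b) : AbsConv (omega2 ρ x₁ x₂) := by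
  have hc0 : 0 ≤ invPairCorr ρ x₁ x₂ := by rw [invPairCorr]; positivity
  have hb0 : 0 ≤ b := hc0.trans hb
  obtain ⟨hD8, hMA, hsum⟩ := smallness_of_le_clusterRadius hM hA hD hb0 hDb
  have hN := hB.starNorm_tail_normD_starMul_normD_le h hm hM hA hD (by linarith) (by linarith)
    hx₁ hx₂
  have hG := hB.starNorm_tail_normD₂_le hM hA hD (by linarith) h12 hx hc0 hb
  have hc : ‖1 - invPairCorr ρ x₁ x₂‖ₑ ≤ ENNReal.ofReal (1 + b) := by
    rw [Real.enorm_eq_ofReal_abs]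
    exact ENNReal.ofReal_le_ofReal (abs_le.2 ⟨by linarith, by linarith⟩)
  refine AbsConv.of_starExp (omega2_empty h h12 hx₁.ne' hx₂.ne' hx.ne')
    (aemeas_starExp_omega2 h hm h12 hx₁.ne' hx₂.ne' hx.ne') ?_
  calc starNorm 2 (tail (starExp (omega2 ρ x₁ x₂)))
      ≤ 2 * (starNorm 2 (tail (normD₂ ρ x₁ x₂)) + ‖1 - invPairCorr ρ x₁ x₂‖ₑ *
          starNorm 2 (tail (starMul (normD ρ x₁) (normD ρ x₂)))) :=
        starNorm_tail_starExp_omega2_le h hm h12 hx₁.ne' hx₂.ne' hx.ne' (hN.trans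
          (ENNReal.ofReal_le_of_le_toReal (by rw [ENNReal.toReal_inv]; norm_num; linarith)))
    _ ≤ 2 * (ENNReal.ofReal (8 * (M * A ^ 2 * b) * D) +
          ENNReal.ofReal (1 + b) * ENNReal.ofReal (12 * (M * A) * D)) := by gcongr
    _ = ENNReal.ofReal (2 * (8 * (M * A ^ 2 * b) * D + (1 + b) * (12 * (M * A) * D))) := by
        rw [ENNReal.ofReal_mul zero_le_two, ENNReal.ofReal_add (q := (1 + b) * _) (by positivity)
          (by positivity), ENNReal.ofReal_mul (p := 1 + b) (by positivity), ENNReal.ofReal_ofNat]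
    _ ≤ 2⁻¹ := ENNReal.ofReal_le_of_le_toReal (by rw [ENNReal.toReal_inv]; norm_num; linarith)

end Bounds

/-! ### Restriction to a region -/

section Restriction

variable {Λ : Set (Space d)} {F : Finset (Space d) → ℝ}

/-- The restriction of a function on finite configurations to the configurations in `Λ`. -/
def res (Λ : Set (Space d)) (F : Finset (Space d) → ℝ) (η : Finset (Space d)) : ℝ :=
  if ↑η ⊆ Λ then F η else 0

theorem res_of_subset {η : Finset (Space d)} (h : ↑η ⊆ Λ) (F : Finset (Space d) → ℝ) :
    res Λ F η = F η :=
  if_pos h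

theorem res_of_not_subset {η : Finset (Space d)} (h : ¬ ↑η ⊆ Λ) (F : Finset (Space d) → ℝ) :
    res Λ F η = 0 :=
  if_neg h

theorem res_smul (Λ : Set (Space d)) (c : ℝ) (F : Finset (Space d) → ℝ) :
    res Λ (c • F) = c • res Λ F := by
  funext η
  simp only [res, Pi.smul_apply, smul_ite, smul_zero]

theorem res_starOne (Λ : Set (Space d)) : res Λ starOne = starOne := by
  funext η
  rcases η.eq_empty_or_nonempty with rfl | h
  · exact res_of_subset (by simp) _
  · simp only [res, starOne_of_nonempty h, ite_self]

theorem res_starMul (Λ : Set (Space d)) (Ψ Φ : Finset (Space d) → ℝ) :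
    res Λ (starMul Ψ Φ) = starMul (res Λ Ψ) (res Λ Φ) := by
  funext η
  by_cases h : ↑η ⊆ Λ
  · rw [res_of_subset h]
    have hsub (F : Finset (Space d) → ℝ) : ∀ γ ⊆ η, F γ = res Λ F γ := fun γ hγ =>
      (res_of_subset ((Finset.coe_subset.2 hγ).trans h) F).symm
    exact starMul_congr (hsub Ψ) (hsub Φ)
  · rw [res_of_not_subset h]
    refine (Finset.sum_eq_zero fun γ hγ => mul_eq_zero.2 ?_).symm
    by_contra! hne
    have hγ' : ↑γ ⊆ Λ := not_not.1 fun hn => hne.1 (res_of_not_subset hn _)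
    have hηγ : ↑(η \ γ) ⊆ Λ := not_not.1 fun hn => hne.2 (res_of_not_subset hn _)
    refine h ?_
    rw [← Finset.union_sdiff_of_subset (Finset.mem_powerset.1 hγ), Finset.coe_union]
    exact Set.union_subset hγ' hηγ

theorem res_starPow (Λ : Set (Space d)) (F : Finset (Space d) → ℝ) (n : ℕ) :
    res Λ (starPow F n) = starPow (res Λ F) n := by
  induction n with
  | zero => exact res_starOne Λ
  | succ n ih => rw [starPow, res_starMul, ih, starPow]

theorem res_starExp (Λ : Set (Space d)) (F : Finset (Space d) → ℝ) :
    res Λ (starExp F) = starExp (res Λ F) := by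
  funext η
  simp only [starExp, ← res_starPow, res]
  split_ifs
  · rfl
  · simp only [mul_zero, tsum_zero]

theorem EqOff.res {Z : Finset (Space d)} {G : Finset (Space d) → ℝ} (h : EqOff Z F G)
    (Λ : Set (Space d)) : EqOff Z (res Λ F) (res Λ G) := fun η hη => by
  simp only [InverseGibbs.res, h η hη]

theorem atPoints_res (Λ : Set (Space d)) (F : Finset (Space d) → ℝ) (k : ℕ) :
    (fun y : Fin k → Space d => atPoints (res Λ F) y) =
      (Set.univ.pi fun _ => Λ).indicator fun y => atPoints F y := by
  funext y
  have hy : ((Finset.univ.image y : Finset (Space d)) : Set (Space d)) ⊆ Λ ↔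
      y ∈ Set.univ.pi fun _ : Fin k => Λ := by
    simp [Set.range_subset_iff]
  simp only [atPoints, res, hy, Set.indicator]

protected theorem AEMeas.res (hF : AEMeas F) (hΛ : MeasurableSet Λ) : AEMeas (res Λ F) :=
  fun k => by
    rw [atPoints_res]
    exact (hF k).indicator (MeasurableSet.univ_pi fun _ => hΛ)

theorem absTerm_res_le (Λ : Set (Space d)) (F : Finset (Space d) → ℝ) (k : ℕ) :
    absTerm (res Λ F) k ≤ absTerm F k := by
  unfold absTerm
  gcongr with y
  rw [congrFun (atPoints_res Λ F k) y]
  exact enorm_indicator_le_enorm_self _ _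

protected theorem AbsConv.res (hF : AbsConv F) (hΛ : MeasurableSet Λ) : AbsConv (res Λ F) :=
  ⟨hF.aemeas.res hΛ, ne_top_of_le_ne_top hF.starNorm_ne_top <| ENNReal.tsum_le_tsum fun k =>
    mul_le_mul_right (absTerm_res_le Λ F k) _⟩

theorem absTerm_res (hΛ : MeasurableSet Λ) (F : Finset (Space d) → ℝ) (k : ℕ) :
    absTerm (res Λ F) k = ENNReal.ofReal (k.factorial : ℝ)⁻¹ *
      ∫⁻ y in Set.univ.pi fun _ : Fin k => Λ, ‖atPoints F y‖ₑ := by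
  rw [absTerm, ← lintegral_indicator (MeasurableSet.univ_pi fun _ => hΛ)]
  simp only [congrFun (atPoints_res Λ F k) _, enorm_indicator_eq_indicator_enorm]

theorem expansionTerm_res (hΛ : MeasurableSet Λ) (F : Finset (Space d) → ℝ) (k : ℕ) :
    expansionTerm (res Λ F) k = (-1) ^ k / (k.factorial : ℝ) *
      ∫ y in Set.univ.pi fun _ : Fin k => Λ, atPoints F y := by
  rw [expansionTerm, ← integral_indicator (MeasurableSet.univ_pi fun _ => hΛ), atPoints_res]

theorem AbsConv.tendsto_expansionTerm_res (hF : AbsConv F) {Λ : ℕ → Set (Space d)}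
    (hmono : Monotone Λ) (hΛ : ∀ i, MeasurableSet (Λ i)) (hU : ⋃ i, Λ i = Set.univ) (k : ℕ) :
    Tendsto (fun i => expansionTerm (InverseGibbs.res (Λ i) F) k) atTop
      (𝓝 (expansionTerm F k)) := by
  have hpi : ⋃ i, Set.univ.pi (fun _ : Fin k => Λ i) = Set.univ := by
    rw [Set.iUnion_univ_pi_of_monotone fun _ => hmono, hU, Set.pi_univ]
  simp only [fun i => expansionTerm_res (hΛ i) F k]
  rw [expansionTerm, ← setIntegral_univ, ← hpi]
  exact (tendsto_setIntegral_of_monotone (fun i => MeasurableSet.univ_pi fun _ => hΛ i)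
    (fun _ _ hij => Set.pi_mono fun _ _ => hmono hij) (hF.integrable k).integrableOn).const_mul _

theorem AbsConv.tendsto_expansion_res (hF : AbsConv F) {Λ : ℕ → Set (Space d)}
    (hmono : Monotone Λ) (hΛ : ∀ i, MeasurableSet (Λ i)) (hU : ⋃ i, Λ i = Set.univ) :
    Tendsto (fun i => expansion (InverseGibbs.res (Λ i) F)) atTop (𝓝 (expansion F)) := by
  have hsum : ∑' k, absTerm F k ≠ ∞ := starNorm_one F ▸ hF.starNorm_ne_top
  refine tendsto_tsum_of_dominated_convergence (bound := fun k => (absTerm F k).toReal)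
    (ENNReal.summable_toReal hsum) (hF.tendsto_expansionTerm_res hmono hΛ hU)
    (Eventually.of_forall fun i k => ?_)
  rw [← toReal_enorm]
  exact ENNReal.toReal_mono (ENNReal.ne_top_of_tsum_ne_top hsum k)
    ((enorm_expansionTerm_le _ k).trans (absTerm_res_le (Λ i) F k))

end Restriction

/-! ### Measurability on the configuration space -/

section Measurability

variable {α : Type*} [MeasurableSpace α] {f : α → Configuration d}

theorem measurable_ncard_inter {Δ : Set (Space d)} (hb : Bornology.IsBounded Δ)
    (hm : MeasurableSet Δ) : Measurable fun η : Configuration d => (η.1 ∩ Δ).ncard :=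
  measurable_to_countable' fun m => MeasurableSpace.measurableSet_generateFrom ⟨Δ, m, hb, hm, rfl⟩

theorem measurable_comp_ncard_inter {β : Type*} [MeasurableSpace β] (g : ℕ → β)
    {Δ : Set (Space d)} (hb : Bornology.IsBounded Δ) (hm : MeasurableSet Δ) :
    Measurable fun η : Configuration d => g (η.1 ∩ Δ).ncard :=
  measurable_from_top.comp (measurable_ncard_inter hb hm)

theorem measurable_configuration (h : ∀ Δ : Set (Space d), Bornology.IsBounded Δ →
    MeasurableSet Δ → Measurable fun a => ((f a).1 ∩ Δ).ncard) : Measurable f := by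
  refine measurable_generateFrom ?_
  rintro _ ⟨Δ, m, hb, hm, rfl⟩
  exact h Δ hb hm (measurableSet_singleton m)

theorem Configuration.isClosed (η : Configuration d) : IsClosed η.1 := by
  refine isClosed_of_closure_subset fun x hx => ?_
  have hfin := η.2 (Metric.ball x 1) Metric.isBounded_ball
  have hx' : x ∈ closure (η.1 ∩ Metric.ball x 1) := by
    rw [mem_closure_iff_nhds] at hx ⊢
    intro t ht
    obtain ⟨y, ⟨hyt, hy⟩, hyη⟩ := hx _ (inter_mem ht (Metric.ball_mem_nhds x one_pos))
    exact ⟨y, hyt, hyη, hy⟩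
  rw [hfin.isClosed.closure_eq] at hx'
  exact hx'.1

theorem Configuration.ncard_inter_ball_ne_zero (η : Configuration d) (z : Space d) (ε : ℝ) :
    (η.1 ∩ Metric.ball z ε).ncard ≠ 0 ↔ ∃ y ∈ η.1, dist y z < ε := by
  rw [Ne, Set.ncard_eq_zero (η.2 _ Metric.isBounded_ball), ← Ne, ← Set.nonempty_iff_ne_empty]
  rfl

theorem Configuration.mem_iff_forall_ncard_ne_zero (η : Configuration d) (x : Space d) :
    x ∈ η.1 ↔ ∀ n : ℕ, ∃ m : ℕ,
      dist x (TopologicalSpace.denseSeq _ m) < 1 / ((n : ℝ) + 1) ∧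
      (η.1 ∩ Metric.ball (TopologicalSpace.denseSeq _ m) (1 / ((n : ℝ) + 1))).ncard ≠ 0 := by
  simp only [ncard_inter_ball_ne_zero]
  refine ⟨fun hx n => ?_, fun h => ?_⟩
  · obtain ⟨m, hm⟩ := (TopologicalSpace.denseRange_denseSeq (Space d)).exists_dist_lt x
      (Nat.one_div_pos_of_nat (α := ℝ) (n := n))
    exact ⟨m, hm, x, hx, hm⟩
  · rw [← η.isClosed.closure_eq, Metric.mem_closure_iff]
    intro ε hε
    obtain ⟨n, hn⟩ := exists_nat_one_div_lt (half_pos hε)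
    obtain ⟨m, hxm, y, hy, hym⟩ := h n
    exact ⟨y, hy, (dist_triangle_right x y _).trans_lt (by linarith)⟩

theorem measurableSet_mem_configuration {g : α → Space d} (hg : Measurable g)
    (hf : Measurable f) : MeasurableSet {a | g a ∈ (f a).1} := by
  simp only [Configuration.mem_iff_forall_ncard_ne_zero, Set.ofPred_forall, Set.ofPred_exists]
  refine MeasurableSet.iInter fun n => MeasurableSet.iUnion fun m =>
    (measurableSet_lt (hg.dist measurable_const) measurable_const).inter ?_
  exact ((measurable_ncard_inter Metric.isBounded_ball measurableSet_ball).comp hf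
    (measurableSet_singleton 0)).compl

theorem Configuration.addPoints_singleton_coe (η : Configuration d) (x : Space d) :
    (η.addPoints {x}).1 = insert x η.1 := by
  simp [addPoints]

theorem Configuration.ncard_addPoints_singleton (η : Configuration d) (x : Space d)
    {Δ : Set (Space d)} (hb : Bornology.IsBounded Δ) :
    ((η.addPoints {x}).1 ∩ Δ).ncard = (η.1 ∩ Δ).ncard + if x ∈ Δ ∧ x ∉ η.1 then 1 else 0 := by
  rw [addPoints_singleton_coe]
  split_ifs with h
  · rw [Set.insert_inter_of_mem h.1, Set.ncard_insert_of_notMem (fun h' => h.2 h'.1) (η.2 Δ hb)]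
  · rw [not_and_not_right] at h
    by_cases hx : x ∈ Δ
    · rw [Set.insert_eq_of_mem (h hx), add_zero]
    · rw [Set.insert_inter_of_notMem hx, add_zero]

theorem measurable_addPoints_singleton {g : α → Space d} (hg : Measurable g)
    (hf : Measurable f) : Measurable fun a => (f a).addPoints {g a} := by
  refine measurable_configuration fun Δ hb hm => ?_
  simp only [Configuration.ncard_addPoints_singleton _ _ hb]
  exact ((measurable_ncard_inter hb hm).comp hf).add (Measurable.ite
    ((hg hm).inter (measurableSet_mem_configuration hg hf).compl)
    measurable_const measurable_const)

theorem Configuration.addPoints_empty (η : Configuration d) : η.addPoints ∅ = η :=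
  Subtype.ext (by simp [addPoints])

theorem measurable_addPoints_image {ι : Type*} {y : α → ι → Space d}
    (hy : ∀ i, Measurable fun a => y a i) (hf : Measurable f) (s : Finset ι) :
    Measurable fun a => (f a).addPoints (s.image (y a)) := by
  induction s using Finset.induction_on with
  | empty => simpa only [Finset.image_empty, Configuration.addPoints_empty] using hf
  | insert i s _ ih =>
    convert measurable_addPoints_singleton (hy i) ih using 2 with a
    exact Subtype.ext (by simp [Configuration.addPoints, Set.union_insert])

theorem measurable_addPoints (γ : Finset (Space d)) :
    Measurable fun η : Configuration d => η.addPoints γ := by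
  simpa using measurable_addPoints_image (y := fun (_ : Configuration d) (z : Space d) => z)
    (fun _ => measurable_const) measurable_id γ

theorem Configuration.mem_inBall {η : Configuration d} {a : Space d} {R : ℝ} {z : Space d} :
    z ∈ η.inBall a R ↔ z ∈ η.1 ∧ dist z a ≤ R := by
  simp [inBall]

theorem measurable_ofFinset_inBall (a : Space d) (R : ℝ) :
    Measurable fun η : Configuration d => Configuration.ofFinset (η.inBall a R) := by
  refine measurable_configuration fun Δ hb hm => ?_
  have hinter (η : Configuration d) : (Configuration.ofFinset (η.inBall a R)).1 ∩ Δ =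
      η.1 ∩ (Metric.closedBall a R ∩ Δ) := by
    simp [Configuration.ofFinset, Configuration.inBall, Set.inter_assoc]
  simp only [hinter]
  exact measurable_ncard_inter (hb.subset Set.inter_subset_right)
    (measurableSet_closedBall.inter hm)

theorem eventually_subset_closedBall (s : Finset (Space d)) :
    ∀ᶠ n : ℕ in atTop, (s : Set (Space d)) ⊆ Metric.closedBall 0 n := by
  obtain ⟨R, hR⟩ := s.finite_toSet.isBounded.subset_closedBall 0
  filter_upwards [tendsto_natCast_atTop_atTop.eventually_ge_atTop R] with n hn
  exact hR.trans (Metric.closedBall_subset_closedBall hn)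

theorem measurable_card_of_ofFinset {g : α → Finset (Space d)}
    (hg : Measurable fun a => Configuration.ofFinset (g a)) : Measurable fun a => (g a).card := by
  have hball (n : ℕ) : Measurable fun a =>
      ((Configuration.ofFinset (g a)).1 ∩ Metric.closedBall 0 n).ncard :=
    (measurable_ncard_inter Metric.isBounded_closedBall measurableSet_closedBall).comp hg
  refine measurable_of_tendsto_metrizable hball
    (tendsto_pi_nhds.2 fun a => tendsto_const_nhds.congr' ?_)
  filter_upwards [eventually_subset_closedBall (g a)] with n hn
  rw [Configuration.ofFinset, Set.inter_eq_left.2 hn, Set.ncard_coe_finset]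

theorem Configuration.ofFinset_union (γ η : Finset (Space d)) :
    ofFinset (γ ∪ η) = (ofFinset η).addPoints γ :=
  Subtype.ext (by simp [ofFinset, addPoints, Set.union_comm])

theorem measurable_ofFinset_union_image {k : ℕ} {y : α → Fin k → Space d} (hy : Measurable y)
    (γ : Finset (Space d)) {η : α → Finset (Space d)}
    (hη : Measurable fun a => Configuration.ofFinset (η a)) :
    Measurable fun a => Configuration.ofFinset (γ ∪ Finset.univ.image (y a) ∪ η a) := by
  simp only [Finset.union_right_comm γ, Finset.union_comm (γ ∪ _), Configuration.ofFinset_union]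
  exact measurable_addPoints_image (fun i => (measurable_pi_apply i).comp hy)
    ((measurable_addPoints γ).comp hη) Finset.univ

theorem measurable_translate (a : Space d) : Measurable (Configuration.translate a) := by
  refine measurable_configuration fun Δ hb hm => ?_
  have hncard (η : Configuration d) : ((η.translate a).1 ∩ Δ).ncard =
      (η.1 ∩ (· + a) ⁻¹' Δ).ncard := by
    rw [Configuration.translate, ← Set.image_inter_preimage,
      Set.ncard_image_of_injective _ (add_left_injective a)]
  simp only [hncard]
  refine measurable_ncard_inter ?_ (measurable_add_const a hm)
  exact (AntilipschitzWith.isBounded_preimage (isometry_add_right a).antilipschitz) hb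

end Measurability

/-! ### Measurability of energies and correlation functions -/

section Energy

variable {μ : ℝ} {H : Finset (Space d) → EReal} {α : Type*} [MeasurableSpace α]

theorem IsHamiltonian.measurable_comp (hH : IsHamiltonian H) {g : α → Finset (Space d)}
    (hg : Measurable fun a => Configuration.ofFinset (g a)) : Measurable fun a => H (g a) :=
  @Measurable.comp _ _ _ _ (MeasurableSpace.comap Configuration.ofFinset inferInstance) _ _ _
    hH.measurable (measurable_comap_iff.2 hg)

theorem IsHamiltonian.measurable_finiteInteraction (hH : IsHamiltonian H)
    {x η : α → Finset (Space d)} (hx : Measurable fun a => Configuration.ofFinset (x a))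
    (hη : Measurable fun a => Configuration.ofFinset (η a))
    (hxη : Measurable fun a => Configuration.ofFinset (x a ∪ η a)) :
    Measurable fun a => finiteInteraction H (x a) (η a) := by
  have hHx := hH.measurable_comp hx
  have hHη := hH.measurable_comp hη
  exact Measurable.ite ((hHx (measurableSet_singleton ⊤)).union (hHη (measurableSet_singleton ⊤)))
    measurable_const (((hH.measurable_comp hxη).sub hHx).sub hHη)

theorem IsHamiltonian.measurable_boltzmann (hH : IsHamiltonian H) {k : ℕ}
    {y : α → Fin k → Space d} {f : α → Configuration d} (hy : Measurable y) (hf : Measurable f)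
    (γ : Finset (Space d)) :
    Measurable fun a => boltzmann μ H (γ ∪ Finset.univ.image (y a)) (f a) := by
  have hx : Measurable fun a => Configuration.ofFinset (γ ∪ Finset.univ.image (y a)) := by
    simpa using measurable_ofFinset_union_image hy γ (η := fun _ => ∅) measurable_const
  have hball (n : ℕ) : Measurable fun a => Configuration.ofFinset ((f a).inBall 0 n) :=
    (measurable_ofFinset_inBall 0 n).comp hf
  have hcard : Measurable fun a =>
      (((γ ∪ Finset.univ.image (y a)).card * μ : ℝ) : EReal) :=
    measurable_coe_real_ereal.comp
      ((measurable_from_top.comp (measurable_card_of_ofFinset hx)).mul_const μ)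
  exact EReal.measurable_exp.comp ((hcard.sub (hH.measurable_comp hx)).sub
    (Measurable.liminf fun n => hH.measurable_finiteInteraction hx (hball n)
      (measurable_ofFinset_union_image hy γ (hball n))))

theorem IsHamiltonian.measurable_boltzmann_right (hH : IsHamiltonian H) (γ : Finset (Space d)) :
    Measurable (boltzmann μ H γ) := by
  simpa using hH.measurable_boltzmann (μ := μ) (y := fun (_ : Configuration d) => Fin.elim0)
    measurable_const measurable_id γ

theorem IsHamiltonian.measurable_correlation (hH : IsHamiltonian H)
    (P : Measure (Configuration d)) [SFinite P] (γ : Finset (Space d)) (k : ℕ) :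
    Measurable fun y : Fin k → Space d => correlation μ H P (γ ∪ Finset.univ.image y) :=
  (hH.measurable_boltzmann (μ := μ) measurable_fst measurable_snd γ).lintegral_prod_right'

end Energy

/-! ### Boltzmann factors of tempered configurations -/

section BoltzmannFactor

variable {μ : ℝ} {H : Finset (Space d) → EReal}

/-- The Boltzmann weight `e^{-H(x)}` of a finite configuration. -/
def weight (H : Finset (Space d) → EReal) (x : Finset (Space d)) : ℝ≥0∞ := EReal.exp (-H x)

theorem IsHamiltonian.ne_bot (hH : IsHamiltonian H) (x : Finset (Space d)) : H x ≠ ⊥ := by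
  obtain ⟨B, -, hB⟩ := hH.stable
  exact ((EReal.bot_lt_coe _).trans_le (hB x)).ne'

theorem weight_eq_zero {x : Finset (Space d)} : weight H x = 0 ↔ H x = ⊤ := by
  rw [weight, EReal.exp_eq_zero_iff, EReal.neg_eq_bot_iff]

theorem IsHamiltonian.weight_ne_top (hH : IsHamiltonian H) (x : Finset (Space d)) :
    weight H x ≠ ∞ := by
  rw [weight, Ne, EReal.exp_eq_top_iff, EReal.neg_eq_top_iff]
  exact hH.ne_bot x

theorem IsHamiltonian.weight_eq_zero_of_subset (hH : IsHamiltonian H) {x y : Finset (Space d)}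
    (hxy : x ⊆ y) (hx : weight H x = 0) : weight H y = 0 :=
  weight_eq_zero.2 (hH.hereditary x y hxy (weight_eq_zero.1 hx))

theorem IsHamiltonian.weight_mul_exp_neg_finiteInteraction (hH : IsHamiltonian H)
    (x η : Finset (Space d)) :
    weight H x * EReal.exp (-finiteInteraction H x η) = weight H (x ∪ η) / weight H η := by
  rw [finiteInteraction]
  split_ifs with h
  · have hunion : weight H (x ∪ η) = 0 := h.elim
      (fun hx => hH.weight_eq_zero_of_subset Finset.subset_union_left (weight_eq_zero.2 hx))
      (fun hη => hH.weight_eq_zero_of_subset Finset.subset_union_right (weight_eq_zero.2 hη))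
    rw [hunion, ENNReal.zero_div, EReal.neg_top, EReal.exp_bot, mul_zero]
  · push Not at h
    rw [weight, weight, weight, ← EReal.exp_add, ENNReal.div_eq_inv_mul, ← EReal.exp_neg, neg_neg,
      ← EReal.exp_add]
    have hxη := hH.ne_bot (x ∪ η)
    generalize H (x ∪ η) = e at hxη ⊢
    lift H x to ℝ using ⟨h.1, hH.ne_bot x⟩ with a
    lift H η to ℝ using ⟨h.2, hH.ne_bot η⟩ with b
    induction e with
    | bot => exact absurd rfl hxη
    | top => simp
    | coe c =>
      norm_cast
      ring_nf

theorem exp_coe_ne_top (c : ℝ) : EReal.exp c ≠ ∞ := by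
  rw [EReal.exp_coe]
  exact ENNReal.ofReal_ne_top

theorem boltzmann_eq (x : Finset (Space d)) (η : Configuration d) :
    boltzmann μ H x η = EReal.exp (x.card * μ : ℝ) *
      (weight H x * EReal.exp (-interaction H x η)) := by
  rw [boltzmann, weight, sub_eq_add_neg, sub_eq_add_neg, EReal.exp_add, EReal.exp_add, mul_assoc]

theorem IsHamiltonian.boltzmann_singleton (hH : IsHamiltonian H) (x : Space d)
    (η : Configuration d) :
    boltzmann μ H {x} η = EReal.exp ((μ : EReal) - interaction H {x} η) := by
  rw [boltzmann, hH.singleton, Finset.card_singleton, Nat.cast_one, one_mul, sub_zero]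

/-- The Boltzmann factor of `x` given the finite configuration `η`; it is `0` if `η` has infinite
energy, since then so has `x ∪ η` and `0 / 0 = 0`. -/
def finiteBoltzmann (μ : ℝ) (H : Finset (Space d) → EReal) (x η : Finset (Space d)) : ℝ≥0∞ :=
  EReal.exp (x.card * μ : ℝ) * (weight H (x ∪ η) / weight H η)

variable {T : Set (Configuration d)} {η : Configuration d} {γ : Finset (Space d)}

theorem IsTemperedSet.interaction_ne_bot (hT : IsTemperedSet H T) (hη : η ∈ T)
    (hγ : Disjoint (γ : Set (Space d)) η.1) : interaction H γ η ≠ ⊥ := by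
  obtain ⟨w, hw, hlim⟩ := hT.limit η hη γ hγ
  rwa [interaction, (hlim 0).liminf_eq]

theorem IsTemperedSet.tendsto_finiteInteraction (hT : IsTemperedSet H T) (hη : η ∈ T)
    (hγ : Disjoint (γ : Set (Space d)) η.1) (a : Space d) :
    Tendsto (fun n : ℕ => finiteInteraction H γ (η.inBall a n)) atTop
      (𝓝 (interaction H γ η)) := by
  obtain ⟨w, -, hlim⟩ := hT.limit η hη γ hγ
  rw [interaction, (hlim 0).liminf_eq]
  exact hlim a

theorem IsTemperedSet.boltzmann_ne_top (hT : IsTemperedSet H T) (hH : IsHamiltonian H)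
    (hη : η ∈ T) (hγ : Disjoint (γ : Set (Space d)) η.1) : boltzmann μ H γ η ≠ ∞ := by
  rw [boltzmann_eq]
  refine ENNReal.mul_ne_top (exp_coe_ne_top _) (ENNReal.mul_ne_top (hH.weight_ne_top γ) ?_)
  rw [Ne, EReal.exp_eq_top_iff, EReal.neg_eq_top_iff]
  exact hT.interaction_ne_bot hη hγ

theorem IsTemperedSet.tendsto_finiteBoltzmann (hT : IsTemperedSet H T) (hH : IsHamiltonian H)
    (hη : η ∈ T) (hγ : Disjoint (γ : Set (Space d)) η.1) :
    Tendsto (fun n : ℕ => finiteBoltzmann μ H γ (η.inBall 0 n)) atTop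
      (𝓝 (boltzmann μ H γ η)) := by
  simp only [finiteBoltzmann, boltzmann_eq, ← hH.weight_mul_exp_neg_finiteInteraction]
  exact ENNReal.Tendsto.const_mul (ENNReal.Tendsto.const_mul
    ((ENNReal.continuous_exp.comp continuous_neg).tendsto _ |>.comp
      (hT.tendsto_finiteInteraction hη hγ 0)) (Or.inr (hH.weight_ne_top γ)))
    (Or.inr (exp_coe_ne_top _))

theorem IsHamiltonian.finiteBoltzmann_insert (hH : IsHamiltonian H) {x : Space d} (hx : x ∉ γ)
    (η : Finset (Space d)) :
    finiteBoltzmann μ H (insert x γ) η =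
      finiteBoltzmann μ H γ (insert x η) * finiteBoltzmann μ H {x} η := by
  have hunion : insert x γ ∪ η = γ ∪ insert x η := by
    rw [Finset.insert_union, Finset.union_insert]
  have hcard : EReal.exp (((insert x γ).card * μ : ℝ) : EReal) =
      EReal.exp ((γ.card * μ : ℝ) : EReal) *
        EReal.exp (((Finset.card {x} : ℕ) * μ : ℝ) : EReal) := by
    rw [← EReal.exp_add, ← EReal.coe_add, ← add_mul, ← Nat.cast_add,
      Finset.card_insert_of_notMem hx, Finset.card_singleton]
  have hchain : weight H (γ ∪ insert x η) / weight H η =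
      weight H (γ ∪ insert x η) / weight H (insert x η) *
        (weight H (insert x η) / weight H η) := by
    by_cases h0 : weight H (insert x η) = 0
    · rw [hH.weight_eq_zero_of_subset Finset.subset_union_right h0]
      simp
    · rw [← mul_div_assoc, ENNReal.div_mul_cancel h0 (hH.weight_ne_top _)]
  rw [finiteBoltzmann, finiteBoltzmann, finiteBoltzmann, hunion, hcard, hchain,
    ← Finset.insert_eq]
  ring

theorem Configuration.eventually_inBall_addPoints_singleton (η : Configuration d) (x : Space d) :
    ∀ᶠ n : ℕ in atTop, (η.addPoints {x}).inBall 0 n = insert x (η.inBall 0 n) := by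
  filter_upwards [eventually_subset_closedBall {x}] with n hn
  have hx : dist x 0 ≤ n := by simpa using hn
  ext z
  simp only [mem_inBall, addPoints_singleton_coe, Set.mem_insert_iff, Finset.mem_insert]
  constructor
  · rintro ⟨rfl | hz, hzn⟩
    exacts [Or.inl rfl, Or.inr ⟨hz, hzn⟩]
  · rintro (rfl | ⟨hz, hzn⟩)
    exacts [⟨Or.inl rfl, hx⟩, ⟨Or.inr hz, hzn⟩]

theorem IsTemperedSet.boltzmann_insert (hT : IsTemperedSet H T) (hH : IsHamiltonian H)
    (hη : η ∈ T) {x : Space d} (hxγ : x ∉ γ) (hxη : x ∉ η.1)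
    (hγη : Disjoint (γ : Set (Space d)) η.1) :
    boltzmann μ H (insert x γ) η =
      boltzmann μ H γ (η.addPoints {x}) * boltzmann μ H {x} η := by
  have hx : Disjoint (({x} : Finset (Space d)) : Set (Space d)) η.1 := by simpa using hxη
  have hη' : η.addPoints {x} ∈ T := hT.addPoints η hη {x}
  have hγ' : Disjoint (γ : Set (Space d)) (η.addPoints {x}).1 := by
    rw [Configuration.addPoints_singleton_coe]
    exact Set.disjoint_insert_right.2 ⟨hxγ, hγη⟩
  have hxγη : Disjoint ((insert x γ : Finset (Space d)) : Set (Space d)) η.1 := by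
    rw [Finset.coe_insert]
    exact Set.disjoint_insert_left.2 ⟨hxη, hγη⟩
  refine tendsto_nhds_unique (hT.tendsto_finiteBoltzmann hH hη hxγη) ?_
  refine (ENNReal.Tendsto.mul (hT.tendsto_finiteBoltzmann hH hη' hγ')
    (Or.inr (hT.boltzmann_ne_top hH hη hx)) (hT.tendsto_finiteBoltzmann hH hη hx)
    (Or.inr (hT.boltzmann_ne_top hH hη' hγ'))).congr' ?_
  filter_upwards [η.eventually_inBall_addPoints_singleton x] with n hn
  rw [hH.finiteBoltzmann_insert hxγ, hn]

end BoltzmannFactor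

/-! ### Gibbs measures -/

section Translation

variable {μ : ℝ} {H : Finset (Space d) → EReal}

theorem Configuration.inBall_translate (η : Configuration d) (a : Space d) (R : ℝ) :
    (η.translate a).inBall 0 R = (η.inBall (-a) R).image (· + a) := by
  ext z
  rw [mem_inBall, Finset.mem_image]
  simp only [mem_inBall, translate, Set.mem_image, dist_eq_norm, sub_zero, sub_neg_eq_add]
  constructor
  · rintro ⟨⟨y, hy, rfl⟩, h⟩
    exact ⟨y, ⟨hy, h⟩, rfl⟩
  · rintro ⟨y, ⟨hy, h⟩, rfl⟩
    exact ⟨⟨y, hy, rfl⟩, h⟩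

theorem IsHamiltonian.finiteInteraction_image_add (hH : IsHamiltonian H) (a : Space d)
    (x η : Finset (Space d)) :
    finiteInteraction H (x.image (· + a)) (η.image (· + a)) = finiteInteraction H x η := by
  rw [finiteInteraction, finiteInteraction, ← Finset.image_union, hH.translate, hH.translate,
    hH.translate]

theorem IsTemperedSet.boltzmann_translate {T : Set (Configuration d)} (hT : IsTemperedSet H T)
    (hH : IsHamiltonian H) {η : Configuration d} (hη : η ∈ T) {γ : Finset (Space d)}
    (hγ : Disjoint (γ : Set (Space d)) η.1) (a : Space d) :
    boltzmann μ H (γ.image (· + a)) (η.translate a) = boltzmann μ H γ η := by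
  have hinteraction : interaction H (γ.image (· + a)) (η.translate a) = interaction H γ η := by
    rw [interaction]
    simp only [Configuration.inBall_translate, hH.finiteInteraction_image_add]
    exact (hT.tendsto_finiteInteraction hη hγ (-a)).liminf_eq
  rw [boltzmann, boltzmann, hinteraction, hH.translate,
    Finset.card_image_of_injective _ (add_left_injective a)]

end Translation

section Gibbs

variable {μ : ℝ} {H : Finset (Space d) → EReal} {P : Measure (Configuration d)}

theorem Configuration.tsum_indicator (η : Configuration d) {Λ : Set (Space d)}
    (hb : Bornology.IsBounded Λ) (c : ℝ≥0∞) :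
    ∑' x : η.1, Λ.indicator (fun _ => c) (x : Space d) = (η.1 ∩ Λ).ncard * c := by
  rw [tsum_subtype η.1 (Λ.indicator fun _ => c), Set.indicator_indicator,
    ← tsum_subtype (η.1 ∩ Λ) fun _ => c, ENNReal.tsum_set_const, ← (η.2 Λ hb).cast_ncard_eq]
  simp

theorem IsGibbs.lintegral_ncard_mul (hG : IsGibbs μ H P) {Λ : Set (Space d)}
    (hb : Bornology.IsBounded Λ) (hm : MeasurableSet Λ) {c : Configuration d → ℝ≥0∞}
    (hc : Measurable c) :
    ∫⁻ η, (η.1 ∩ Λ).ncard * c η ∂P = ∫⁻ x in Λ, ∫⁻ η, c (η.addPoints {x}) *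
      EReal.exp ((μ : EReal) - interaction H {x} η) ∂P := by
  have hgnz := hG.gnz (fun x η => Λ.indicator (fun _ => c η) x)
    ((hc.comp measurable_snd).indicator (measurable_fst hm))
  simp only [Configuration.tsum_indicator _ hb] at hgnz
  rw [hgnz, ← lintegral_indicator hm]
  refine lintegral_congr fun x => ?_
  by_cases hx : x ∈ Λ <;> simp [hx]

theorem IsGibbs.ae_inter_eq_empty (hG : IsGibbs μ H P) {Δ : Set (Space d)}
    (hb : Bornology.IsBounded Δ) (hm : MeasurableSet Δ) (h0 : volume Δ = 0) :
    ∀ᵐ η ∂P, η.1 ∩ Δ = ∅ := by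
  have hcount := hG.lintegral_ncard_mul hb hm (measurable_const (a := 1))
  simp only [mul_one, setLIntegral_measure_zero Δ _ h0] at hcount
  rw [lintegral_eq_zero_iff (measurable_comp_ncard_inter ((↑) : ℕ → ℝ≥0∞) hb hm)] at hcount
  filter_upwards [hcount] with η hη
  exact (Set.ncard_eq_zero (η.2 Δ hb)).1 (Nat.cast_eq_zero.1 hη)

theorem IsGibbs.ae_disjoint [Nontrivial (Space d)] (hG : IsGibbs μ H P) (γ : Finset (Space d)) :
    ∀ᵐ η ∂P, Disjoint (γ : Set (Space d)) η.1 := by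
  filter_upwards [hG.ae_inter_eq_empty γ.finite_toSet.isBounded γ.measurableSet
    (γ.finite_toSet.measure_zero volume)] with η hη
  exact (Set.disjoint_iff_inter_eq_empty.2 hη).symm

theorem IsGibbs.correlation_empty [IsProbabilityMeasure P] (hG : IsGibbs μ H P)
    (hH : IsHamiltonian H) : correlation μ H P ∅ = 1 := by
  have hboltzmann : ∀ᵐ η ∂P, boltzmann μ H ∅ η = 1 := by
    filter_upwards [hG.finite_energy] with η hη
    have hfinite (n : ℕ) : finiteInteraction H ∅ (η.inBall 0 n) = 0 := by
      rw [finiteInteraction, hH.empty, if_neg (by simp [hη n]), Finset.empty_union, sub_zero]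
      exact EReal.sub_self (hη n) (hH.ne_bot _)
    simp [boltzmann, interaction, hfinite, hH.empty]
  rw [correlation, lintegral_congr_ae hboltzmann, lintegral_one, measure_univ]

theorem IsGibbs.rho_empty [IsProbabilityMeasure P] (hG : IsGibbs μ H P) (hH : IsHamiltonian H) :
    rho μ H P ∅ = 1 := by
  rw [rho, hG.correlation_empty hH, ENNReal.toReal_one]

theorem IsGibbs.correlation_image_add [Nontrivial (Space d)] (hG : IsGibbs μ H P)
    (hH : IsHamiltonian H) (hP : TranslationInvariant P) (γ : Finset (Space d)) (a : Space d) :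
    correlation μ H P (γ.image (· + a)) = correlation μ H P γ := by
  obtain ⟨T, hT, hPT⟩ := hG.tempered
  have hmap : P.map (Configuration.translate a) = P := by
    ext S hS
    rw [Measure.map_apply (measurable_translate a) hS, hP a S hS]
  rw [correlation, ← hmap,
    lintegral_map (hH.measurable_boltzmann_right _) (measurable_translate a), hmap]
  refine lintegral_congr_ae ?_
  filter_upwards [hPT, hG.ae_disjoint γ] with η hη hγ
  exact hT.boltzmann_translate hH hη hγ a

theorem IsGibbs.correlation_singleton [Nontrivial (Space d)] (hG : IsGibbs μ H P)
    (hH : IsHamiltonian H) (hP : TranslationInvariant P) (x : Space d) :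
    correlation μ H P {x} = correlation μ H P {0} := by
  simpa using hG.correlation_image_add hH hP {0} x

end Gibbs

/-! ### Janossy densities -/

section Janossy

variable {μ : ℝ} {H : Finset (Space d) → EReal} {P : Measure (Configuration d)}
  {Λ : Set (Space d)}

/-- The `k`-th factorial moment of the number of points in `Λ`, weighted with the Boltzmann factor
of a finite set `γ` of further points. -/
def factorialMoment (μ : ℝ) (H : Finset (Space d) → EReal) (P : Measure (Configuration d))
    (Λ : Set (Space d)) (k : ℕ) (γ : Finset (Space d)) : ℝ≥0∞ :=
  ∫⁻ η, ((η.1 ∩ Λ).ncard.descFactorial k : ℝ≥0∞) * boltzmann μ H γ η ∂P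

theorem IsHamiltonian.measurable_mul_boltzmann (hH : IsHamiltonian H) (hb : Bornology.IsBounded Λ)
    (hm : MeasurableSet Λ) (g : ℕ → ℝ≥0∞) (γ : Finset (Space d)) :
    Measurable fun η : Configuration d => g (η.1 ∩ Λ).ncard * boltzmann μ H γ η :=
  (measurable_comp_ncard_inter g hb hm).mul (hH.measurable_boltzmann_right γ)

theorem IsGibbs.factorialMoment_succ [Nontrivial (Space d)] (hG : IsGibbs μ H P)
    (hH : IsHamiltonian H) (hb : Bornology.IsBounded Λ) (hm : MeasurableSet Λ) (k : ℕ)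
    (γ : Finset (Space d)) :
    factorialMoment μ H P Λ (k + 1) γ = ∫⁻ x in Λ, factorialMoment μ H P Λ k (insert x γ) := by
  obtain ⟨T, hT, hPT⟩ := hG.tempered
  have hdescFactorial (n : ℕ) :
      (n.descFactorial (k + 1) : ℝ≥0∞) = n * (n - 1).descFactorial k := by
    cases n with
    | zero => simp
    | succ n => rw [Nat.succ_descFactorial_succ, Nat.cast_mul, Nat.add_sub_cancel]
  simp only [factorialMoment, hdescFactorial, mul_assoc]
  rw [hG.lintegral_ncard_mul hb hm
    (hH.measurable_mul_boltzmann hb hm (fun n => ((n - 1).descFactorial k : ℕ)) γ)]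
  have hγ : ∀ᵐ x : Space d, x ∉ γ :=
    measure_eq_zero_iff_ae_notMem.1 (γ.finite_toSet.measure_zero volume)
  refine lintegral_congr_ae ?_
  filter_upwards [ae_restrict_mem hm, ae_restrict_of_ae hγ] with x hxΛ hxγ
  refine lintegral_congr_ae ?_
  filter_upwards [hPT, hG.ae_disjoint (insert x γ)] with η hη hdisj
  rw [Finset.coe_insert, Set.disjoint_insert_left] at hdisj
  rw [hT.boltzmann_insert hH hη hxγ hdisj.1 hdisj.2, hH.boltzmann_singleton,
    Configuration.ncard_addPoints_singleton _ _ hb, if_pos ⟨hxΛ, hdisj.1⟩, Nat.add_sub_cancel,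
    mul_assoc]

theorem setLIntegral_pi_succ {k : ℕ} {f : (Fin (k + 1) → Space d) → ℝ≥0∞} (hf : Measurable f) :
    ∫⁻ y in Set.univ.pi fun _ => Λ, f y =
      ∫⁻ x in Λ, ∫⁻ y in Set.univ.pi fun _ : Fin k => Λ, f (Fin.cons x y) := by
  rw [volume_pi, volume_pi, Measure.restrict_pi_pi, Measure.restrict_pi_pi]
  have hmp := measurePreserving_piFinSuccAbove
    (fun _ : Fin (k + 1) => (volume : Measure (Space d)).restrict Λ) 0
  rw [← hmp.symm.lintegral_comp hf,
    lintegral_prod (fun a => f ((MeasurableEquiv.piFinSuccAbove (fun _ => Space d) 0).symm a))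
      (hf.comp (MeasurableEquiv.measurable _)).aemeasurable]
  exact lintegral_congr fun x => lintegral_congr fun y => congrArg f (Fin.insertNth_zero' x y)

theorem union_image_cons (γ : Finset (Space d)) (x : Space d) {k : ℕ} (y : Fin k → Space d) :
    γ ∪ Finset.univ.image (Fin.cons x y : Fin (k + 1) → Space d) =
      insert x γ ∪ Finset.univ.image y := by
  ext z
  simp only [Finset.mem_union, Finset.mem_insert, Finset.mem_image, Finset.mem_univ, true_and,
    Fin.exists_fin_succ, Fin.cons_zero, Fin.cons_succ, eq_comm (a := z)]
  tauto

theorem IsGibbs.factorialMoment_eq [Nontrivial (Space d)] [SFinite P] (hG : IsGibbs μ H P)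
    (hH : IsHamiltonian H) (hb : Bornology.IsBounded Λ) (hm : MeasurableSet Λ) (k : ℕ)
    (γ : Finset (Space d)) :
    factorialMoment μ H P Λ k γ = ∫⁻ y in Set.univ.pi fun _ : Fin k => Λ,
      correlation μ H P (γ ∪ Finset.univ.image y) := by
  induction k generalizing γ with
  | zero => simp [factorialMoment, correlation, volume_pi_pi]
  | succ k ih =>
    rw [hG.factorialMoment_succ hH hb hm, setLIntegral_pi_succ (hH.measurable_correlation P γ _)]
    simp only [ih, union_image_cons]

theorem IsGibbs.exists_correlation_le [IsProbabilityMeasure P] (hG : IsGibbs μ H P)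
    (hH : IsHamiltonian H) (hR : RuelleBound μ H P) :
    ∃ ξ : ℝ, 0 < ξ ∧ ∀ x : Finset (Space d),
      correlation μ H P x ≤ ENNReal.ofReal (ξ ^ x.card) := by
  obtain ⟨ξ, hξ, h⟩ := hR
  refine ⟨ξ, hξ, fun x => ?_⟩
  rcases x.eq_empty_or_nonempty with rfl | hx
  · simp [hG.correlation_empty hH]
  · exact h x hx

theorem IsGibbs.correlation_ne_top [IsProbabilityMeasure P] (hG : IsGibbs μ H P)
    (hH : IsHamiltonian H) (hR : RuelleBound μ H P) (x : Finset (Space d)) :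
    correlation μ H P x ≠ ∞ := by
  obtain ⟨ξ, -, h⟩ := hG.exists_correlation_le hH hR
  exact ne_top_of_le_ne_top ENNReal.ofReal_ne_top (h x)

theorem atPoints_dOp_ae_eq [Nontrivial (Space d)] (γ : Finset (Space d))
    (F : Finset (Space d) → ℝ) (k : ℕ) :
    (fun y : Fin k → Space d => atPoints (dOp γ F) y) =ᵐ[volume]
      fun y => F (γ ∪ Finset.univ.image y) := by
  filter_upwards [ae_disjoint_finset γ k] with y hy
  rw [atPoints, dOp, if_pos hy, Finset.union_comm]

theorem IsHamiltonian.aemeas_dOp_rho [Nontrivial (Space d)] [SFinite P] (hH : IsHamiltonian H)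
    (γ : Finset (Space d)) : AEMeas (dOp γ (rho μ H P)) := fun k =>
  (hH.measurable_correlation P γ k).ennreal_toReal.aestronglyMeasurable.congr
    (atPoints_dOp_ae_eq γ (rho μ H P) k).symm

theorem IsGibbs.exists_factorialMoment_le [Nontrivial (Space d)] [IsProbabilityMeasure P]
    (hG : IsGibbs μ H P) (hH : IsHamiltonian H) (hR : RuelleBound μ H P)
    (hb : Bornology.IsBounded Λ) (hm : MeasurableSet Λ) :
    ∃ ξ : ℝ, ∀ (k : ℕ) (γ : Finset (Space d)), factorialMoment μ H P Λ k γ ≤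
      ENNReal.ofReal (ξ ^ γ.card * (ξ * (volume Λ).toReal) ^ k) := by
  obtain ⟨ξ, hξ, hle⟩ := hG.exists_correlation_le hH hR
  refine ⟨ξ, fun k γ => ?_⟩
  have hcorrelation : ∀ᵐ y : Fin k → Space d,
      correlation μ H P (γ ∪ Finset.univ.image y) ≤ ENNReal.ofReal (ξ ^ (γ.card + k)) := by
    filter_upwards [ae_injective k, ae_disjoint_finset γ k] with y hy hyγ
    refine (hle _).trans_eq ?_
    rw [Finset.card_union_of_disjoint hyγ.symm, card_image_univ hy]
  rw [hG.factorialMoment_eq hH hb hm]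
  refine (lintegral_mono_ae (ae_restrict_of_ae hcorrelation)).trans_eq ?_
  rw [lintegral_const, Measure.restrict_apply_univ, volume_pi_pi, Finset.prod_const,
    Finset.card_univ, Fintype.card_fin, mul_pow, ← mul_assoc, ← pow_add,
    ENNReal.ofReal_mul (by positivity), ENNReal.ofReal_pow ENNReal.toReal_nonneg,
    ENNReal.ofReal_toReal hb.measure_lt_top.ne]

theorem IsGibbs.factorialMoment_ne_top [Nontrivial (Space d)] [IsProbabilityMeasure P]
    (hG : IsGibbs μ H P) (hH : IsHamiltonian H) (hR : RuelleBound μ H P)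
    (hb : Bornology.IsBounded Λ) (hm : MeasurableSet Λ) (k : ℕ) (γ : Finset (Space d)) :
    factorialMoment μ H P Λ k γ ≠ ∞ := by
  obtain ⟨ξ, hle⟩ := hG.exists_factorialMoment_le hH hR hb hm
  exact ne_top_of_le_ne_top ENNReal.ofReal_ne_top (hle k γ)

theorem IsGibbs.absTerm_res_dOp_rho [Nontrivial (Space d)] [IsProbabilityMeasure P]
    (hG : IsGibbs μ H P) (hH : IsHamiltonian H) (hR : RuelleBound μ H P)
    (hb : Bornology.IsBounded Λ) (hm : MeasurableSet Λ) (k : ℕ) (γ : Finset (Space d)) :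
    absTerm (res Λ (dOp γ (rho μ H P))) k =
      ENNReal.ofReal (k.factorial : ℝ)⁻¹ * factorialMoment μ H P Λ k γ := by
  rw [absTerm_res hm, hG.factorialMoment_eq hH hb hm]
  congr 1
  refine lintegral_congr_ae (ae_restrict_of_ae ?_)
  filter_upwards [atPoints_dOp_ae_eq γ (rho μ H P) k] with y hy
  rw [hy, rho, Real.enorm_eq_ofReal ENNReal.toReal_nonneg,
    ENNReal.ofReal_toReal (hG.correlation_ne_top hH hR _)]

theorem IsGibbs.expansionTerm_res_dOp_rho [Nontrivial (Space d)] [IsProbabilityMeasure P]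
    (hG : IsGibbs μ H P) (hH : IsHamiltonian H) (hR : RuelleBound μ H P)
    (hb : Bornology.IsBounded Λ) (hm : MeasurableSet Λ) (k : ℕ) (γ : Finset (Space d)) :
    expansionTerm (res Λ (dOp γ (rho μ H P))) k =
      (-1) ^ k / (k.factorial : ℝ) * (factorialMoment μ H P Λ k γ).toReal := by
  rw [expansionTerm_res hm, hG.factorialMoment_eq hH hb hm,
    integral_congr_ae (ae_restrict_of_ae (atPoints_dOp_ae_eq γ (rho μ H P) k))]
  congr 1
  exact integral_toReal (hH.measurable_correlation P γ k).aemeasurable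
    (Eventually.of_forall fun y => (hG.correlation_ne_top hH hR _).lt_top)

theorem IsGibbs.absConv_res_dOp_rho [Nontrivial (Space d)] [IsProbabilityMeasure P]
    (hG : IsGibbs μ H P) (hH : IsHamiltonian H) (hR : RuelleBound μ H P)
    (hb : Bornology.IsBounded Λ) (hm : MeasurableSet Λ) (γ : Finset (Space d)) :
    AbsConv (res Λ (dOp γ (rho μ H P))) := by
  obtain ⟨ξ, hle⟩ := hG.exists_factorialMoment_le hH hR hb hm
  have hsum : Summable fun k : ℕ =>
      ξ ^ γ.card * ((ξ * (volume Λ).toReal) ^ k / (k.factorial : ℝ)) :=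
    (Real.summable_pow_div_factorial _).mul_left _
  refine ⟨(hH.aemeas_dOp_rho γ).res hm, ?_⟩
  rw [starNorm_one]
  refine ne_top_of_le_ne_top hsum.tsum_ofReal_ne_top (ENNReal.tsum_le_tsum fun k => ?_)
  rw [hG.absTerm_res_dOp_rho hH hR hb hm]
  refine (mul_le_mul_right (hle k γ) _).trans_eq ?_
  rw [← ENNReal.ofReal_mul (by positivity)]
  congr 1
  ring

theorem tsum_neg_one_pow_div_factorial_mul_descFactorial (n : ℕ) :
    ∑' k : ℕ, (-1 : ℝ) ^ k / (k.factorial : ℝ) * (n.descFactorial k : ℝ) =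
      if n = 0 then 1 else 0 := by
  have hterm (k : ℕ) : (-1 : ℝ) ^ k / (k.factorial : ℝ) * (n.descFactorial k : ℝ) =
      ((-1) ^ k * n.choose k : ℤ) := by
    rw [Nat.descFactorial_eq_factorial_mul_choose]
    push_cast
    field_simp
  simp only [hterm]
  rw [tsum_eq_sum (s := Finset.range (n + 1)) fun k hk => by
    rw [Nat.choose_eq_zero_of_lt (by simpa using hk), Nat.cast_zero, mul_zero, Int.cast_zero],
    ← Int.cast_sum, Int.alternating_sum_range_choose]
  push_cast
  rfl

theorem Configuration.ncard_inter_eq_zero (η : Configuration d) (hb : Bornology.IsBounded Λ) :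
    (η.1 ∩ Λ).ncard = 0 ↔ η.1 ∩ Λ = ∅ :=
  Set.ncard_eq_zero (η.2 Λ hb)

theorem measurableSet_inter_eq_empty (hb : Bornology.IsBounded Λ) (hm : MeasurableSet Λ) :
    MeasurableSet {η : Configuration d | η.1 ∩ Λ = ∅} := by
  simp only [← Configuration.ncard_inter_eq_zero _ hb]
  exact measurable_ncard_inter hb hm (measurableSet_singleton 0)

theorem IsGibbs.janossy_eq_integral_tsum [IsProbabilityMeasure P] (hG : IsGibbs μ H P)
    (hH : IsHamiltonian H) (hR : RuelleBound μ H P) (hb : Bornology.IsBounded Λ)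
    (hm : MeasurableSet Λ) (γ : Finset (Space d)) :
    janossy μ H P Λ γ = ∫ η : Configuration d, ∑' k : ℕ, (-1 : ℝ) ^ k / (k.factorial : ℝ) *
      ((η.1 ∩ Λ).ncard.descFactorial k * boltzmann μ H γ η).toReal ∂P := by
  have hindicator (η : Configuration d) : ∑' k : ℕ, (-1 : ℝ) ^ k / (k.factorial : ℝ) *
      ((η.1 ∩ Λ).ncard.descFactorial k * boltzmann μ H γ η).toReal =
      {η : Configuration d | η.1 ∩ Λ = ∅}.indicator (fun η => (boltzmann μ H γ η).toReal) η := by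
    simp only [ENNReal.toReal_mul, ENNReal.toReal_natCast, ← mul_assoc]
    rw [tsum_mul_right, tsum_neg_one_pow_div_factorial_mul_descFactorial, ite_mul, one_mul,
      zero_mul]
    simp only [η.ncard_inter_eq_zero hb, Set.indicator, Set.mem_ofPred_eq]
  have hbm := hH.measurable_boltzmann_right (μ := μ) γ
  simp only [hindicator]
  rw [integral_indicator (measurableSet_inter_eq_empty hb hm), integral_toReal hbm.aemeasurable
    (ae_restrict_of_ae (ae_lt_top hbm (hG.correlation_ne_top hH hR γ))), janossy]

theorem IsGibbs.janossy_eq_expansion [Nontrivial (Space d)] [IsProbabilityMeasure P]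
    (hG : IsGibbs μ H P) (hH : IsHamiltonian H) (hR : RuelleBound μ H P)
    (hb : Bornology.IsBounded Λ) (hm : MeasurableSet Λ) (γ : Finset (Space d)) :
    janossy μ H P Λ γ = expansion (res Λ (dOp γ (rho μ H P))) := by
  let g (k : ℕ) (η : Configuration d) : ℝ≥0∞ :=
    (η.1 ∩ Λ).ncard.descFactorial k * boltzmann μ H γ η
  have hgm (k : ℕ) : Measurable (g k) :=
    hH.measurable_mul_boltzmann hb hm (fun n => (n.descFactorial k : ℕ)) γ
  have hgfin (k : ℕ) : ∫⁻ η, g k η ∂P ≠ ∞ := hG.factorialMoment_ne_top hH hR hb hm k γ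
  have hgint (k : ℕ) : ∫ η, (g k η).toReal ∂P = (factorialMoment μ H P Λ k γ).toReal :=
    integral_toReal (hgm k).aemeasurable (ae_lt_top (hgm k) (hgfin k))
  have hterm (k : ℕ) : ∫ η, (-1 : ℝ) ^ k / (k.factorial : ℝ) * (g k η).toReal ∂P =
      expansionTerm (res Λ (dOp γ (rho μ H P))) k := by
    rw [integral_const_mul, hgint, hG.expansionTerm_res_dOp_rho hH hR hb hm]
  have hnorm (k : ℕ) : ∫ η, ‖(-1 : ℝ) ^ k / (k.factorial : ℝ) * (g k η).toReal‖ ∂P =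
      (absTerm (res Λ (dOp γ (rho μ H P))) k).toReal := by
    simp only [norm_mul, norm_div, norm_pow, norm_neg, norm_one, one_pow, Real.norm_natCast,
      one_div, Real.norm_of_nonneg ENNReal.toReal_nonneg]
    rw [integral_const_mul, hgint, hG.absTerm_res_dOp_rho hH hR hb hm, ENNReal.toReal_mul,
      ENNReal.toReal_ofReal (by positivity)]
  rw [hG.janossy_eq_integral_tsum hH hR hb hm, expansion, ← tsum_congr hterm]
  refine (hasSum_integral_of_summable_integral_norm
    (fun k => (integrable_toReal_of_lintegral_ne_top (hgm k).aemeasurable (hgfin k)).const_mul _)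
    ?_).tsum_eq.symm
  simp only [hnorm]
  exact ENNReal.summable_toReal
    (starNorm_one (d := d) _ ▸ (hG.absConv_res_dOp_rho hH hR hb hm γ).starNorm_ne_top)

end Janossy

/-! ### The thermodynamic limit -/

section Limit

variable [Nontrivial (Space d)] {μ : ℝ} {H : Finset (Space d) → EReal}
  {P : Measure (Configuration d)} {ρ ω : Finset (Space d) → ℝ} {γ : Finset (Space d)} {c : ℝ}
  {x x₁ x₂ : Space d}

theorem expansion_res_eq_mul_exp {Λ : Set (Space d)} {F : Finset (Space d) → ℝ}
    (hρ : AbsConv (res Λ ρ)) (hω : AbsConv (res Λ ω))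
    (hF : EqOff γ F (starMul ρ (c • starExp ω))) :
    expansion (res Λ F) = expansion (res Λ ρ) * (c * Real.exp (expansion (res Λ ω))) := by
  rw [(hF.res Λ).expansion_eq, res_starMul, res_smul, res_starExp,
    hρ.expansion_starMul (hω.starExp.smul c), expansion_smul, hω.expansion_starExp]

variable [IsProbabilityMeasure P]

theorem IsGibbs.tendsto_janossy_div (hG : IsGibbs μ H P) (hH : IsHamiltonian H)
    (hR : RuelleBound μ H P) (hω : AbsConv ω)
    (hγ : EqOff γ (dOp γ (rho μ H P)) (starMul (rho μ H P) (c • starExp ω)))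
    {Λ : ℕ → Set (Space d)} (hmono : Monotone Λ) (hb : ∀ i, Bornology.IsBounded (Λ i))
    (hm : ∀ i, MeasurableSet (Λ i)) (hU : ⋃ i, Λ i = Set.univ)
    (h0 : ∀ᶠ i in atTop, janossy μ H P (Λ i) ∅ ≠ 0) :
    Tendsto (fun i => janossy μ H P (Λ i) γ / janossy μ H P (Λ i) ∅) atTop
      (𝓝 (c * Real.exp (expansion ω))) := by
  have hlim := (hω.tendsto_expansion_res hmono hm hU).rexp.const_mul c
  refine hlim.congr' (h0.mono fun i hi => ?_)
  have hρ := hG.absConv_res_dOp_rho hH hR (hb i) (hm i) ∅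
  have hj := hG.janossy_eq_expansion hH hR (hb i) (hm i) ∅
  rw [dOp_empty] at hρ hj
  rw [eq_div_iff hi, hj, hG.janossy_eq_expansion hH hR (hb i) (hm i) γ,
    expansion_res_eq_mul_exp hρ (hω.res (hm i)) hγ, mul_comm]

theorem IsGibbs.toReal_exp_sub_hamiltonian (hG : IsGibbs μ H P) (hH : IsHamiltonian H)
    (hR : RuelleBound μ H P) (hA : AssumptionA μ H P) (hcard : γ.card = 1 ∨ γ.card = 2)
    (hω : AbsConv ω) (hγ : EqOff γ (dOp γ (rho μ H P)) (starMul (rho μ H P) (c • starExp ω))) :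
    (EReal.exp (((γ.card * μ : ℝ) : EReal) - H γ)).toReal = c * Real.exp (expansion ω) := by
  obtain ⟨Λ, hmono, hb, hm, hU, hlim⟩ := hA
  have hratio (γ : Finset (Space d)) (hcard : γ.card = 1 ∨ γ.card = 2) :
      Tendsto (fun i => janossy μ H P (Λ i) γ / janossy μ H P (Λ i) ∅) atTop
        (𝓝 (EReal.exp (((γ.card * μ : ℝ) : EReal) - H γ)).toReal) :=
    (hlim γ.card hcard γ γ.finite_toSet.isBounded).tendsto_at ⟨rfl, subset_rfl⟩
  have hpos : 0 < (EReal.exp (((({0} : Finset (Space d)).card * μ : ℝ) : EReal) -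
      H {0})).toReal := by
    rw [hH.singleton, sub_zero, EReal.exp_coe, ENNReal.toReal_ofReal (Real.exp_pos _).le]
    exact Real.exp_pos _
  have h0 : ∀ᶠ i in atTop, janossy μ H P (Λ i) ∅ ≠ 0 :=
    ((hratio {0} (.inl (Finset.card_singleton 0))).eventually_ne hpos.ne').mono
      fun i hi h => hi (by rw [h, div_zero])
  exact tendsto_nhds_unique (hratio γ hcard) (hG.tendsto_janossy_div hH hR hω hγ hmono hb hm hU h0)

theorem IsGibbs.hamiltonian_eq (hG : IsGibbs μ H P) (hH : IsHamiltonian H)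
    (hR : RuelleBound μ H P) (hA : AssumptionA μ H P) (hcard : γ.card = 1 ∨ γ.card = 2)
    (hc : 0 < c) (hω : AbsConv ω)
    (hγ : EqOff γ (dOp γ (rho μ H P)) (starMul (rho μ H P) (c • starExp ω))) :
    H γ = ((γ.card * μ - Real.log c - expansion ω : ℝ) : EReal) := by
  have hexp := hG.toReal_exp_sub_hamiltonian hH hR hA hcard hω hγ
  have hpos : 0 < c * Real.exp (expansion ω) := by positivity
  have htop : H γ ≠ ⊤ := by
    intro htop
    rw [htop, EReal.sub_top, EReal.exp_bot, ENNReal.toReal_zero] at hexp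
    exact hpos.ne hexp
  lift H γ to ℝ using ⟨htop, hH.ne_bot γ⟩ with e
  rw [← EReal.coe_sub, EReal.exp_coe, ENNReal.toReal_ofReal (Real.exp_pos _).le,
    ← Real.exp_log hc, ← Real.exp_add, Real.exp_eq_exp] at hexp
  rw [EReal.coe_eq_coe_iff]
  linarith

theorem IsGibbs.expansion_omega1 (hG : IsGibbs μ H P) (hH : IsHamiltonian H)
    (hR : RuelleBound μ H P) (hA : AssumptionA μ H P) (hx : 0 < rho μ H P {x})
    (hω : AbsConv (omega1 (rho μ H P) x)) :
    expansion (omega1 (rho μ H P) x) = μ - Real.log (rho μ H P {x}) := by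
  have hHx := hG.hamiltonian_eq hH hR hA (.inl (Finset.card_singleton x)) hx hω
    (dOp_singleton_eq_starExp (hG.rho_empty hH) hx.ne')
  rw [hH.singleton, Finset.card_singleton, Nat.cast_one, one_mul, ← EReal.coe_zero,
    EReal.coe_eq_coe_iff] at hHx
  linarith

theorem IsGibbs.hamiltonian_pair (hG : IsGibbs μ H P) (hH : IsHamiltonian H)
    (hR : RuelleBound μ H P) (hA : AssumptionA μ H P) (h12 : x₁ ≠ x₂)
    (hx₁ : 0 < rho μ H P {x₁}) (hx₂ : 0 < rho μ H P {x₂}) (hx : 0 < rho μ H P {x₁, x₂})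
    (hω₁ : AbsConv (omega1 (rho μ H P) x₁)) (hω₂ : AbsConv (omega1 (rho μ H P) x₂))
    (hω : AbsConv (omega2 (rho μ H P) x₁ x₂)) :
    H {x₁, x₂} = ((-Real.log (rho μ H P {x₁, x₂} / (rho μ H P {x₁} * rho μ H P {x₂})) -
      expansion (omega2 (rho μ H P) x₁ x₂) : ℝ) : EReal) := by
  rw [hG.hamiltonian_eq hH hR hA (.inr (Finset.card_pair h12)) hx (hω.add (hω₁.add hω₂))
    (dOp_pair_eq_starExp (hG.rho_empty hH) h12 hx₁.ne' hx₂.ne' hx.ne'),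
    hω.expansion_add (hω₁.add hω₂), hω₁.expansion_add hω₂, hG.expansion_omega1 hH hR hA hx₁ hω₁,
    hG.expansion_omega1 hH hR hA hx₂ hω₂, Finset.card_pair h12,
    Real.log_div hx.ne' (mul_pos hx₁ hx₂).ne', Real.log_mul hx₁.ne' hx₂.ne', EReal.coe_eq_coe_iff]
  push_cast
  ring

end Limit

end InverseGibbs

end

theorem theorem3p1_general (d : ℕ) (hd : 1 ≤ d) (M A r dr : ℝ) (hM : 0 < M) (hA : 0 < A)
    (hr : 0 < r) :
    ∃ D₀ : ℝ, 0 < D₀ ∧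
      ∀ (μ : ℝ) (H : Finset (Space d) → EReal) (P : Measure (Configuration d))
        (D : ℝ) (ρ : Finset (Space d) → ℝ),
        IsProbabilityMeasure P → IsHamiltonian H → IsGibbs μ H P → RuelleBound μ H P →
        ρ = rho μ H P → AssumptionA μ H P → 0 < D → D ≤ D₀ → AssumptionB ρ M A D →
        AssumptionC ρ r dr →
        truncated ρ ∅ = 0 ∧ ρ = starExp (truncated ρ) ∧
        (∀ x : Space d, omega1 ρ x ∅ = 0) ∧
        (∀ (x : Space d) (η : Finset (Space d)),
          dOp {x} (truncated ρ) η / ρ {x} = starExp (omega1 ρ x) η) ∧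
        (∀ x₁ x₂ : Space d, r ≤ dist x₁ x₂ → omega2 ρ x₁ x₂ ∅ = 0) ∧
        (∀ x₁ x₂ : Space d, r ≤ dist x₁ x₂ → ∀ η : Finset (Space d),
          dOp {x₁, x₂} (truncated ρ) η / ρ {x₁, x₂} =
            starMul (starMul
              (fun ζ => starExp (omega2 ρ x₁ x₂) ζ -
                ρ {x₁} * ρ {x₂} / ρ {x₁, x₂} * starOne ζ)
              (fun ζ => dOp {x₁} (truncated ρ) ζ / ρ {x₁}))
              (fun ζ => dOp {x₂} (truncated ρ) ζ / ρ {x₂}) η) ∧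
        (∀ x : Space d,
          (∀ k : ℕ, 1 ≤ k → Integrable (fun y : Fin k → Space d => atPoints (omega1 ρ x) y)) ∧
          Summable (fun k : ℕ => expansionTerm (omega1 ρ x) (k + 1)) ∧
          μ = Real.log (ρ {x}) + ∑' k : ℕ, expansionTerm (omega1 ρ x) (k + 1)) ∧
        (∀ x₁ x₂ : Space d, r ≤ dist x₁ x₂ →
          (∀ k : ℕ, 1 ≤ k → Integrable (fun y : Fin k → Space d => atPoints (omega2 ρ x₁ x₂) y)) ∧
          Summable (fun k : ℕ => expansionTerm (omega2 ρ x₁ x₂) (k + 1)) ∧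
          H {x₁, x₂} =
            ((-Real.log (ρ {x₁, x₂} / (ρ {x₁} * ρ {x₂})) -
              ∑' k : ℕ, expansionTerm (omega2 ρ x₁ x₂) (k + 1) : ℝ) : EReal)) := by
  have : Nontrivial (Space d) := nontrivial_space hd
  refine ⟨clusterRadius M A |dr|, clusterRadius_pos hM hA (abs_nonneg dr), ?_⟩
  rintro μ H P D _ hP hH hG hR rfl hjanossy hD hD₀ hB hC
  have hempty := hG.rho_empty hH
  have hsep {x₁ x₂ : Space d} (hx : r ≤ dist x₁ x₂) : x₁ ≠ x₂ := dist_pos.1 (hr.trans_le hx)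
  have hpair {x₁ x₂ : Space d} (hx : r ≤ dist x₁ x₂) : 0 < rho μ H P {x₁, x₂} :=
    hC.pair_pos (fun _ => ENNReal.toReal_nonneg) hx
  have hω₀ {x₁ x₂ : Space d} (hx : r ≤ dist x₁ x₂) : omega2 (rho μ H P) x₁ x₂ ∅ = 0 :=
    omega2_empty hempty (hsep hx) (hC.1 x₁).ne' (hC.1 x₂).ne' (hpair hx).ne'
  have hω₁ (x : Space d) : AbsConv (omega1 (rho μ H P) x) :=
    absConv_omega1 hempty hH.aemeas_dOp_rho hB hM hA hD (abs_nonneg dr) hD₀ (hC.1 x)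
  have hω₂ {x₁ x₂ : Space d} (hx : r ≤ dist x₁ x₂) : AbsConv (omega2 (rho μ H P) x₁ x₂) :=
    absConv_omega2 hempty hH.aemeas_dOp_rho hB hM hA hD hD₀ (hsep hx) (hC.1 x₁) (hC.1 x₂)
      (hpair hx) ((hC.invPairCorr_le (fun _ => ENNReal.toReal_nonneg) hx).trans (le_abs_self dr))
  refine ⟨truncated_empty hempty, (starExp_truncated hempty).symm,
    fun x => omega1_empty hempty (hC.1 x).ne',
    fun x η => (congrFun (starExp_omega1 hempty (hC.1 x).ne') η).symm, fun _ _ => hω₀,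
    fun x₁ x₂ hx η => (div_eq_inv_mul _ _).trans (congrFun (normD₂_eq_starMul hempty (hsep hx)
      (hC.1 x₁).ne' (hC.1 x₂).ne' (hpair hx).ne') η),
    fun x => ⟨fun k _ => (hω₁ x).integrable k, (hω₁ x).summable_expansionTerm_succ, ?_⟩,
    fun x₁ x₂ hx => ⟨fun k _ => (hω₂ hx).integrable k, (hω₂ hx).summable_expansionTerm_succ, ?_⟩⟩
  · rw [← (hω₁ x).expansion_eq_tsum (omega1_empty hempty (hC.1 x).ne'),
      hG.expansion_omega1 hH hR hjanossy (hC.1 x) (hω₁ x), add_sub_cancel]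
  · rw [← (hω₂ hx).expansion_eq_tsum (hω₀ hx)]
    exact hG.hamiltonian_pair hH hR hjanossy (hsep hx) (hC.1 x₁) (hC.1 x₂) (hpair hx) (hω₁ x₁)
      (hω₁ x₂) (hω₂ hx)

theorem theorem3p1 (d : ℕ) (hd : 1 ≤ d) (M A r dr : ℝ) (hM : 0 < M) (hA : 0 < A) (hr : 0 < r) :
    ∃ D₀ : ℝ, 0 < D₀ ∧
      ∀ (μ : ℝ) (H : Finset (Space d) → EReal) (P : Measure (Configuration d))
        (D : ℝ) (ρ : Finset (Space d) → ℝ),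
        IsProbabilityMeasure P → IsHamiltonian H → IsGibbs μ H P → TranslationInvariant P →
        RuelleBound μ H P → ρ = rho μ H P →
        AssumptionA μ H P → 0 < D → D ≤ D₀ → AssumptionB ρ M A D → AssumptionC ρ r dr →
        -- the density is constant
        (∀ x : Space d, ρ {x} = ρ {0}) ∧
        -- `ρ_T`, `ω_x` and `ω_{x₁,x₂}` satisfy the equations by which they are defined
        truncated ρ ∅ = 0 ∧ ρ = starExp (truncated ρ) ∧
        (∀ x : Space d, omega1 ρ x ∅ = 0) ∧
        (∀ (x : Space d) (η : Finset (Space d)),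
          dOp {x} (truncated ρ) η / ρ {x} = starExp (omega1 ρ x) η) ∧
        (∀ x₁ x₂ : Space d, r ≤ dist x₁ x₂ → omega2 ρ x₁ x₂ ∅ = 0) ∧
        (∀ x₁ x₂ : Space d, r ≤ dist x₁ x₂ → ∀ η : Finset (Space d),
          dOp {x₁, x₂} (truncated ρ) η / ρ {x₁, x₂} =
            starMul (starMul
              (fun ζ => starExp (omega2 ρ x₁ x₂) ζ -
                ρ {x₁} * ρ {x₂} / ρ {x₁, x₂} * starOne ζ)
              (fun ζ => dOp {x₁} (truncated ρ) ζ / ρ {x₁}))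
              (fun ζ => dOp {x₂} (truncated ρ) ζ / ρ {x₂}) η) ∧
        -- the expansion of the chemical potential
        ((∀ k : ℕ, 1 ≤ k → Integrable (fun y : Fin k → Space d => atPoints (omega1 ρ 0) y)) ∧
          Summable (fun k : ℕ => expansionTerm (omega1 ρ 0) (k + 1)) ∧
          μ = Real.log (ρ {0}) + ∑' k : ℕ, expansionTerm (omega1 ρ 0) (k + 1)) ∧
        -- the expansion of the pair interaction
        (∀ x₁ x₂ : Space d, r ≤ dist x₁ x₂ →
          (∀ k : ℕ, 1 ≤ k → Integrable (fun y : Fin k → Space d => atPoints (omega2 ρ x₁ x₂) y)) ∧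
          Summable (fun k : ℕ => expansionTerm (omega2 ρ x₁ x₂) (k + 1)) ∧
          H {x₁, x₂} =
            ((-Real.log (ρ {x₁, x₂} / ρ {0} ^ 2) -
              ∑' k : ℕ, expansionTerm (omega2 ρ x₁ x₂) (k + 1) : ℝ) : EReal)) := by
  obtain ⟨D₀, hD₀, hgeneral⟩ := theorem3p1_general d hd M A r dr hM hA hr
  refine ⟨D₀, hD₀, fun μ H P D ρ hP hH hG hTI hR hρ hjanossy hD hDD₀ hB hC => ?_⟩
  have hconst (x : Space d) : ρ {x} = ρ {0} := by
    have := nontrivial_space hd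
    rw [hρ, rho, rho, hG.correlation_singleton hH hTI]
  obtain ⟨hT, hexp, hω₁, heq₁, hω₂, heq₂, hμ, hpair⟩ :=
    hgeneral μ H P D ρ hP hH hG hR hρ hjanossy hD hDD₀ hB hC
  refine ⟨hconst, hT, hexp, hω₁, heq₁, hω₂, heq₂, hμ 0, fun x₁ x₂ hx => ?_⟩
  simpa only [hconst x₁, hconst x₂, ← sq] using hpair x₁ x₂ hx
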